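/- Let $\mathrm{Cospan}$ be the strict symmetric monoidal category whose objects are the natural numbers $m$ (standing for the finite sets $\underline m=\{1,\dots,m\}$), whose morphisms $m\to n$ are isomorphism classes of cospans of functions $\underline m\to\underline p\leftarrow\underline n$ (two cospans being isomorphic if a bijection of their apexes commutes with both legs), composed by pushout, with monoidal product given by disjoint union (so $m\oplus n=m+n$, with unit $0$) and braiding given by exchanging blocks. Let $\mu\colon 2\to 1$, $\eta\colon 0\to 1$, $\delta\colon 1\to 2$, $\epsilon\colon 1\to 0$ be the unique cospans of these types with apex $\underline 1$. Let $(\mathcal C,\otimes,I)$ be a symmetric monoidal category. A special commutative Frobenius monoid in $\mathcal C$ is an object $X$ with morphisms $\mu_X\colon X\otimes X\to X$, $\eta_X\colon I\to X$, $\delta_X\colon X\to X\otimes X$, $\epsilon_X\colon X\to I$ such that $(X,\mu_X,\eta_X)$ is a commutative monoid, $(X,\delta_X,\epsilon_X)$ is a cocommutative comonoid, and, suppressing associators and with $\circ$ denoting composition, $(\mathrm{id}_X\otimes\mu_X)\circ(\delta_X\otimes \mathrm{id}_X)=\delta_X\circ\mu_X=(\mu_X\otimes \mathrm{id}_X)\circ(\mathrm{id}_X\otimes\delta_X)$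 and $\mu_X\circ\delta_X=\mathrm{id}_X$. Consider (strong) symmetric monoidal functors $(F,\varphi)\colon\mathrm{Cospan}\to\mathcal C$, where the coherence isomorphisms $\varphi_\varnothing\colon I\to F0$ and $\varphi_{m,n}\colon Fm\otimes Fn\to F(m+n)$ are part of the data. Call $(F,\varphi)$ strict if $F0=I$, $Fm\otimes Fn=F(m+n)$ for all $m,n$, and $\varphi_\varnothing$ and all $\varphi_{m,n}$ are identities. Call it strict on powers if $F0=I$ with $\varphi_\varnothing=\mathrm{id}$, and $F(n+1)=Fn\otimes F1$ with $\varphi_{n,1}=\mathrm{id}$ for all $n\ge 1$; thus $F$ sends $m\ge 1$ to the left-bracketed tensor power $(\cdots(X\otimes X)\otimes\cdots)\otimes X$ of $X=F1$. Then the assignment \[ (F,\varphi)\longmapsto\bigl(F1,\; F\mu\circ\varphi_{1,1},\; F\eta\circ\varphi_\varnothing,\; \varphi_{1,1}^{-1}\circ F\delta,\; \varphi_\varnothing^{-1}\circ F\epsilon\bigr) \] is a bijection from the symmetric monoidal functors $\mathrm{Cospan}\to\mathcal C$ that are strict on powers to the special commutative Frobenius monoids in $\mathcal C$. If moreover the monoidal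 category $\mathcal C$ is strict (its associators and unitors are identities), then the same assignment is a bijection from the strict symmetric monoidal functors $\mathrm{Cospan}\to\mathcal C$ to the special commutative Frobenius monoids in $\mathcal C$. -/

import Mathlib

open CategoryTheory MonoidalCategory

universe v u

/-- The objects of the category of finite sets and cospans, in its strict skeletal form: the natural
number `card` stands for the finite set `Fin card`. -/
@[ext]
structure FinCospan : Type where
  card : ℕ

namespace FinCospan

/-- A cospan of finite sets `Fin m → Fin apex ← Fin n`. -/
structure Rep (m n : ℕ) : Type where
  apex : ℕ
  left : Fin m → Fin apex
  right : Fin n → Fin apex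

/-- Two cospans are isomorphic if a bijection of their apexes commutes with both legs. -/
instance repSetoid (m n : ℕ) : Setoid (Rep m n) where
  r c d := ∃ e : Fin c.apex ≃ Fin d.apex, e ∘ c.left = d.left ∧ e ∘ c.right = d.right
  iseqv :=
    { refl := fun _ => ⟨Equiv.refl _, rfl, rfl⟩
      symm := by
        rintro c d ⟨e, h1, h2⟩
        refine ⟨e.symm, ?_, ?_⟩
        · rw [← h1]; funext x; simp
        · rw [← h2]; funext x; simp
      trans := by
        rintro c d k ⟨e, h1, h2⟩ ⟨e', h3, h4⟩
        refine ⟨e.trans e', ?_, ?_⟩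
        · rw [← h3, ← h1]; rfl
        · rw [← h4, ← h2]; rfl }

/-- Morphisms are isomorphism classes of cospans. -/
def CHom (m n : ℕ) : Type := Quotient (repSetoid m n)

/-- The isomorphism class of a cospan `Fin m → A ← Fin n` whose apex is any finite type `A`:
the apex is replaced by `Fin (Nat.card A)` through a bijection. -/
noncomputable def cls {m n : ℕ} (A : Type) [Finite A] (f : Fin m → A) (g : Fin n → A) : CHom m n :=
  Quotient.mk (repSetoid m n) ⟨Nat.card A, Finite.equivFin A ∘ f, Finite.equivFin A ∘ g⟩

theorem cls_eq_cls {m n : ℕ} {A B : Type} [Finite A] [Finite B] {f : Fin m → A} {g : Fin n → A}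
    {f' : Fin m → B} {g' : Fin n → B} (e : A ≃ B) (hf : ∀ x, e (f x) = f' x)
    (hg : ∀ x, e (g x) = g' x) : cls A f g = cls B f' g' := by
  refine Quotient.sound ⟨(Finite.equivFin A).symm.trans (e.trans (Finite.equivFin B)), ?_, ?_⟩
  · funext x; simp [hf]
  · funext x; simp [hg]

theorem cls_fin {m n : ℕ} (c : Rep m n) :
    cls (Fin c.apex) c.left c.right = Quotient.mk (repSetoid m n) c := by
  refine Quotient.sound ⟨(Finite.equivFin (Fin c.apex)).symm, ?_, ?_⟩ <;>
  · funext x; simp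

theorem CHom.ind {m n : ℕ} (c : CHom m n) :
    ∃ (p : ℕ) (f : Fin m → Fin p) (g : Fin n → Fin p), c = cls (Fin p) f g := by
  induction c using Quotient.inductionOn with
  | h c => exact ⟨c.apex, c.left, c.right, (cls_fin c).symm⟩

/-- The pushout of `A ← S → B`: the disjoint union of `A` and `B` with `g s` and `h s` glued. -/
def Pushout {S A B : Type} (g : S → A) (h : S → B) : Type :=
  Quot (fun x y : A ⊕ B => ∃ s, x = Sum.inl (g s) ∧ y = Sum.inr (h s))

def Pushout.inl {S A B : Type} (g : S → A) (h : S → B) (a : A) : Pushout g h :=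
  Quot.mk _ (Sum.inl a)

def Pushout.inr {S A B : Type} (g : S → A) (h : S → B) (b : B) : Pushout g h :=
  Quot.mk _ (Sum.inr b)

instance {S A B : Type} [Finite A] [Finite B] (g : S → A) (h : S → B) : Finite (Pushout g h) :=
  inferInstanceAs (Finite (Quot _))

/-- The square with legs `g`, `h` and cocone `i`, `j` is a pushout square of sets. -/
structure IsPO {S A B P : Type} (g : S → A) (h : S → B) (i : A → P) (j : B → P) : Prop where
  comm : ∀ s, i (g s) = j (h s)
  desc : ∀ (T : Type) (a : A → T) (b : B → T), (∀ s, a (g s) = b (h s)) →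
    ∃ w : P → T, (∀ x, w (i x) = a x) ∧ ∀ x, w (j x) = b x
  surj : ∀ x : P, (∃ a, i a = x) ∨ ∃ b, j b = x

theorem isPO_pushout {S A B : Type} (g : S → A) (h : S → B) :
    IsPO g h (Pushout.inl g h) (Pushout.inr g h) where
  comm s := Quot.sound ⟨s, rfl, rfl⟩
  desc T a b hab := ⟨Quot.lift (Sum.elim a b) (by
    rintro _ _ ⟨s, rfl, rfl⟩; exact hab s), fun _ => rfl, fun _ => rfl⟩
  surj x := by
    induction x using Quot.ind with
    | mk x => cases x with
      | inl a => exact Or.inl ⟨a, rfl⟩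
      | inr b => exact Or.inr ⟨b, rfl⟩

theorem IsPO.unique {S A B P Q : Type} {g : S → A} {h : S → B} {i : A → P} {j : B → P}
    {i' : A → Q} {j' : B → Q} (hP : IsPO g h i j) (hQ : IsPO g h i' j') :
    ∃ e : P ≃ Q, (∀ a, e (i a) = i' a) ∧ ∀ b, e (j b) = j' b := by
  obtain ⟨w, w1, w2⟩ := hP.desc Q i' j' hQ.comm
  obtain ⟨w', w1', w2'⟩ := hQ.desc P i j hP.comm
  refine ⟨⟨w, w', fun x => ?_, fun x => ?_⟩, w1, w2⟩
  · rcases hP.surj x with ⟨a, rfl⟩ | ⟨b, rfl⟩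
    · rw [w1, w1']
    · rw [w2, w2']
  · rcases hQ.surj x with ⟨a, rfl⟩ | ⟨b, rfl⟩
    · rw [w1', w1]
    · rw [w2', w2]

theorem IsPO.of_equiv {S A B A' B' P : Type} {g : S → A} {h : S → B} {i : A → P} {j : B → P}
    {g' : S → A'} {h' : S → B'} (hP : IsPO g h i j) (e : A' ≃ A) (e' : B' ≃ B)
    (hg : ∀ s, e (g' s) = g s) (hh : ∀ s, e' (h' s) = h s) :
    IsPO g' h' (i ∘ e) (j ∘ e') where
  comm s := by simp [hg, hh, hP.comm]
  desc T a b hab := by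
    obtain ⟨w, w1, w2⟩ := hP.desc T (a ∘ e.symm) (b ∘ e'.symm) (fun s => by
      simp [← hg, ← hh, hab])
    exact ⟨w, fun x => by simp [w1], fun x => by simp [w2]⟩
  surj x := by
    rcases hP.surj x with ⟨a, rfl⟩ | ⟨b, rfl⟩
    · exact Or.inl ⟨e.symm a, by simp⟩
    · exact Or.inr ⟨e'.symm b, by simp⟩

/-- Composition of cospans by pushout over the common foot. -/
noncomputable def comp {m n k : ℕ} : CHom m n → CHom n k → CHom m k :=
  Quotient.lift₂
    (fun c d => cls (Pushout c.right d.left)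
      (Pushout.inl c.right d.left ∘ c.left) (Pushout.inr c.right d.left ∘ d.right)) (by
    rintro c d c' d' ⟨e, h1, h2⟩ ⟨e', h3, h4⟩
    obtain ⟨E, E1, E2⟩ := (isPO_pushout c.right d.left).unique
      ((isPO_pushout c'.right d'.left).of_equiv e e' (congrFun h2) (congrFun h3))
    refine cls_eq_cls E (fun x => ?_) (fun x => ?_)
    · simp [E1, ← h1]
    · simp [E2, ← h4])

theorem comp_cls {m n k : ℕ} {A B P : Type} [Finite A] [Finite B] [Finite P]
    {f : Fin m → A} {g : Fin n → A} {h : Fin n → B} {l : Fin k → B} {i : A → P} {j : B → P}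
    (hP : IsPO g h i j) : comp (cls A f g) (cls B h l) = cls P (i ∘ f) (j ∘ l) := by
  obtain ⟨E, E1, E2⟩ := (isPO_pushout (Finite.equivFin A ∘ g) (Finite.equivFin B ∘ h)).unique
    (hP.of_equiv (Finite.equivFin A).symm (Finite.equivFin B).symm (fun s => by simp)
      (fun s => by simp))
  exact cls_eq_cls E (fun x => by simp [E1]) (fun x => by simp [E2])

/-- The cospan `Fin m → Fin n = Fin n` of a function. -/
noncomputable def ofFun {m n : ℕ} (f : Fin m → Fin n) : CHom m n := cls (Fin n) f id

theorem ofFun_comp_cls {m n k : ℕ} {A : Type} [Finite A] (f : Fin m → Fin n) (g : Fin n → A)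
    (h : Fin k → A) : comp (ofFun f) (cls A g h) = cls A (g ∘ f) h :=
  comp_cls (i := g) (j := id)
    { comm := fun _ => rfl
      desc := fun _ _ b hab => ⟨b, fun x => (hab x).symm, fun _ => rfl⟩
      surj := fun x => Or.inr ⟨x, rfl⟩ }

theorem cls_comp_ofFun {m n k : ℕ} {A : Type} [Finite A] (e : Fin n ≃ Fin k) (g : Fin m → A)
    (h : Fin n → A) : comp (cls A g h) (ofFun e) = cls A g (h ∘ e.symm) :=
  comp_cls (i := id) (j := h ∘ e.symm)
    { comm := fun s => by simp
      desc := fun _ a b hab => ⟨a, fun _ => rfl, fun x => by simp [hab]⟩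
      surj := fun x => Or.inl ⟨x, rfl⟩ }

theorem ofFun_comp_ofFun {m n k : ℕ} (f : Fin m → Fin n) (g : Fin n → Fin k) :
    comp (ofFun f) (ofFun g) = ofFun (g ∘ f) := ofFun_comp_cls f g id

theorem comp_assoc {m n k l : ℕ} (a : CHom m n) (b : CHom n k) (c : CHom k l) :
    comp (comp a b) c = comp a (comp b c) := by
  obtain ⟨p, f, g, rfl⟩ := a.ind
  obtain ⟨q, f', g', rfl⟩ := b.ind
  obtain ⟨r, f'', g'', rfl⟩ := c.ind
  have h1 := isPO_pushout g f'
  have h2 := isPO_pushout g' f''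
  have h3 := isPO_pushout (Pushout.inr g f') (Pushout.inl g' f'')
  set P := Pushout g f'
  set Q := Pushout g' f''
  rw [comp_cls h1, comp_cls h2]
  refine (comp_cls (i := Pushout.inl (Pushout.inr g f') (Pushout.inl g' f''))
    (j := Pushout.inr (Pushout.inr g f') (Pushout.inl g' f'') ∘ Pushout.inr g' f'') ?_).trans
    (comp_cls (i := Pushout.inl (Pushout.inr g f') (Pushout.inl g' f'') ∘ Pushout.inl g f')
      (j := Pushout.inr (Pushout.inr g f') (Pushout.inl g' f'')) ?_).symm
  · constructor
    · intro s
      simp only [Function.comp_apply]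
      rw [h3.comm, h2.comm]
    · intro T a b hab
      obtain ⟨w, w1, w2⟩ := h2.desc T (a ∘ Pushout.inr g f') b hab
      obtain ⟨z, z1, z2⟩ := h3.desc T a w (fun s => (w1 s).symm)
      exact ⟨z, z1, fun x => by simp [z2, w2]⟩
    · intro x
      rcases h3.surj x with ⟨a, rfl⟩ | ⟨b, rfl⟩
      · exact Or.inl ⟨a, rfl⟩
      · rcases h2.surj b with ⟨a, rfl⟩ | ⟨b, rfl⟩
        · exact Or.inl ⟨_, h3.comm a⟩
        · exact Or.inr ⟨b, rfl⟩
  · constructor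
    · intro s
      simp only [Function.comp_apply]
      rw [h1.comm, h3.comm]
    · intro T a b hab
      obtain ⟨w, w1, w2⟩ := h1.desc T a (b ∘ Pushout.inl g' f'') hab
      obtain ⟨z, z1, z2⟩ := h3.desc T w b w2
      exact ⟨z, fun x => by simp [z1, w1], z2⟩
    · intro x
      rcases h3.surj x with ⟨a, rfl⟩ | ⟨b, rfl⟩
      · rcases h1.surj a with ⟨a, rfl⟩ | ⟨b, rfl⟩
        · exact Or.inl ⟨a, rfl⟩
        · exact Or.inr ⟨_, (h3.comm b).symm⟩
      · exact Or.inr ⟨b, rfl⟩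

noncomputable instance : Category.{0} FinCospan where
  Hom a b := CHom a.card b.card
  id _ := ofFun id
  comp := comp
  id_comp c := by
    obtain ⟨p, f, g, rfl⟩ := CHom.ind c
    exact ofFun_comp_cls id f g
  comp_id c := by
    obtain ⟨p, f, g, rfl⟩ := CHom.ind c
    exact cls_comp_ofFun (Equiv.refl _) f g
  assoc := comp_assoc

/-- A pair of functions out of `Fin m` and `Fin n` as a function out of `Fin (m + n)`, whose first
`m` elements are the copy of `Fin m`. -/
def sumMap {m n : ℕ} {A B : Type} (f : Fin m → A) (g : Fin n → B) : Fin (m + n) → A ⊕ B :=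
  Sum.map f g ∘ finSumFinEquiv.symm

/-- The sum of two cospans: disjoint unions of the feet and of the apexes. -/
noncomputable def tensor {m n m' n' : ℕ} : CHom m n → CHom m' n' → CHom (m + m') (n + n') :=
  Quotient.lift₂
    (fun c d => cls (Fin c.apex ⊕ Fin d.apex) (sumMap c.left d.left) (sumMap c.right d.right)) (by
    rintro c d c' d' ⟨e, h1, h2⟩ ⟨e', h3, h4⟩
    refine cls_eq_cls (Equiv.sumCongr e e') (fun x => ?_) (fun x => ?_)
    · simp only [sumMap, Function.comp_apply, ← h1, ← h3]
      rcases finSumFinEquiv.symm x <;> rfl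
    · simp only [sumMap, Function.comp_apply, ← h2, ← h4]
      rcases finSumFinEquiv.symm x <;> rfl)

theorem tensor_cls {m n m' n' : ℕ} {A B : Type} [Finite A] [Finite B] (f : Fin m → A)
    (g : Fin n → A) (f' : Fin m' → B) (g' : Fin n' → B) :
    tensor (cls A f g) (cls B f' g') = cls (A ⊕ B) (sumMap f f') (sumMap g g') := by
  refine cls_eq_cls (Equiv.sumCongr (Finite.equivFin A).symm (Finite.equivFin B).symm)
    (fun x => ?_) (fun x => ?_) <;>
  · simp only [sumMap, Function.comp_apply]
    rcases finSumFinEquiv.symm x <;> simp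

theorem tensor_ofFun {m n m' n' : ℕ} (f : Fin m → Fin n) (g : Fin m' → Fin n') :
    tensor (ofFun f) (ofFun g) = ofFun (finSumFinEquiv ∘ sumMap f g) := by
  refine (tensor_cls f id g id).trans (cls_eq_cls finSumFinEquiv (fun x => rfl) (fun x => ?_))
  simp [sumMap]

theorem tensor_comp {m n k m' n' k' : ℕ} (a : CHom m n) (b : CHom n k) (a' : CHom m' n')
    (b' : CHom n' k') :
    tensor (comp a b) (comp a' b') = comp (tensor a a') (tensor b b') := by
  obtain ⟨p, f, g, rfl⟩ := a.ind
  obtain ⟨q, h, l, rfl⟩ := b.ind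
  obtain ⟨p', f', g', rfl⟩ := a'.ind
  obtain ⟨q', h', l', rfl⟩ := b'.ind
  have h1 := isPO_pushout g h
  have h2 := isPO_pushout g' h'
  rw [comp_cls h1, comp_cls h2, tensor_cls, tensor_cls, tensor_cls]
  refine Eq.trans ?_ (comp_cls (i := Sum.map (Pushout.inl g h) (Pushout.inl g' h'))
    (j := Sum.map (Pushout.inr g h) (Pushout.inr g' h')) ?_).symm
  · refine cls_eq_cls (Equiv.refl _) (fun x => ?_) (fun x => ?_) <;>
    · simp only [sumMap, Function.comp_apply]
      rcases finSumFinEquiv.symm x <;> rfl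
  · constructor
    · intro s
      simp only [sumMap, Function.comp_apply]
      rcases finSumFinEquiv.symm s with s | s
      · exact congrArg Sum.inl (h1.comm s)
      · exact congrArg Sum.inr (h2.comm s)
    · intro T a b hab
      obtain ⟨w, w1, w2⟩ := h1.desc T (a ∘ Sum.inl) (b ∘ Sum.inl) (fun s => by
        simpa [sumMap] using hab (finSumFinEquiv (Sum.inl s)))
      obtain ⟨z, z1, z2⟩ := h2.desc T (a ∘ Sum.inr) (b ∘ Sum.inr) (fun s => by
        simpa [sumMap] using hab (finSumFinEquiv (Sum.inr s)))
      refine ⟨Sum.elim w z, ?_, ?_⟩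
      · rintro (x | x)
        · exact w1 x
        · exact z1 x
      · rintro (x | x)
        · exact w2 x
        · exact z2 x
    · rintro (x | x)
      · rcases h1.surj x with ⟨a, rfl⟩ | ⟨b, rfl⟩
        · exact Or.inl ⟨Sum.inl a, rfl⟩
        · exact Or.inr ⟨Sum.inl b, rfl⟩
      · rcases h2.surj x with ⟨a, rfl⟩ | ⟨b, rfl⟩
        · exact Or.inl ⟨Sum.inr a, rfl⟩
        · exact Or.inr ⟨Sum.inr b, rfl⟩

/-- The isomorphism in the cospan category given by a bijection of finite sets. -/
noncomputable def isoOfEquiv {a b : FinCospan} (e : Fin a.card ≃ Fin b.card) : a ≅ b where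
  hom := ofFun e
  inv := ofFun e.symm
  hom_inv_id := (ofFun_comp_ofFun e e.symm).trans (by simp; rfl)
  inv_hom_id := (ofFun_comp_ofFun e.symm e).trans (by simp; rfl)

/-- The exchange of two blocks, `Fin (m + n) ≃ Fin (n + m)`. -/
def swapEquiv (m n : ℕ) : Fin (m + n) ≃ Fin (n + m) :=
  finSumFinEquiv.symm.trans ((Equiv.sumComm _ _).trans finSumFinEquiv)

/-- Sum of finite sets as monoidal product, with associator and unitors the identity
re-indexings `Fin (a + b + c) = Fin (a + (b + c))`, `Fin (0 + n) = Fin n`, `Fin (n + 0) = Fin n`. -/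
noncomputable instance : MonoidalCategoryStruct FinCospan where
  tensorObj a b := ⟨a.card + b.card⟩
  tensorUnit := ⟨0⟩
  tensorHom f g := tensor f g
  whiskerLeft a _ _ g := tensor (𝟙 a) g
  whiskerRight f b := tensor f (𝟙 b)
  associator a b c := isoOfEquiv (finCongr (Nat.add_assoc a.card b.card c.card))
  leftUnitor a := isoOfEquiv (finCongr (Nat.zero_add a.card))
  rightUnitor a := isoOfEquiv (finCongr (Nat.add_zero a.card))

@[simp]
theorem sumMap_castAdd {m n : ℕ} {A B : Type} (f : Fin m → A) (g : Fin n → B) (x : Fin m) :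
    sumMap f g (Fin.castAdd n x) = Sum.inl (f x) := by simp [sumMap]

@[simp]
theorem sumMap_natAdd {m n : ℕ} {A B : Type} (f : Fin m → A) (g : Fin n → B) (x : Fin n) :
    sumMap f g (Fin.natAdd m x) = Sum.inr (g x) := by simp [sumMap]

theorem sumMap_assoc {a b c : ℕ} {A B C : Type} (f : Fin a → A) (g : Fin b → B) (h : Fin c → C)
    (x : Fin (a + b + c)) : Equiv.sumAssoc A B C (sumMap (sumMap f g) h x) =
      sumMap f (sumMap g h) (finCongr (Nat.add_assoc a b c) x) := by
  induction x using Fin.addCases with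
  | left x =>
    induction x using Fin.addCases with
    | left x =>
      have : finCongr (Nat.add_assoc a b c) (Fin.castAdd c (Fin.castAdd b x)) =
        Fin.castAdd (b + c) x := by ext; simp
      rw [this]; simp
    | right x =>
      have : finCongr (Nat.add_assoc a b c) (Fin.castAdd c (Fin.natAdd a x)) =
        Fin.natAdd a (Fin.castAdd c x) := by ext; simp
      rw [this]; simp
  | right x =>
    have : finCongr (Nat.add_assoc a b c) (Fin.natAdd (a + b) x) =
      Fin.natAdd a (Fin.natAdd b x) := by ext; simp [Nat.add_assoc]
    rw [this]; simp

theorem sumMap_swap {a b : ℕ} {A B : Type} (f : Fin a → A) (g : Fin b → B) (x : Fin (a + b)) :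
    Sum.swap (sumMap f g x) = sumMap g f (swapEquiv a b x) := by
  induction x using Fin.addCases with
  | left x => simp [swapEquiv]
  | right x => simp [swapEquiv]

theorem tensor_id_id (m n : ℕ) : tensor (ofFun (id : Fin m → Fin m)) (ofFun (id : Fin n → Fin n)) =
    ofFun id := by
  rw [tensor_ofFun]
  congr 1
  funext x
  simp [sumMap]

theorem val_sumMap_eq {m n m' n' : ℕ} (f : Fin m → Fin n) (g : Fin m' → Fin n')
    (x : Fin (m + m')) : (finSumFinEquiv (sumMap f g x)).val =
      if h : x.val < m then (f ⟨x, h⟩).val else n + (g ⟨x - m, by omega⟩).val := by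
  induction x using Fin.addCases with
  | left x => simp
  | right x => simp

theorem val_sumMap {m n m' n' : ℕ} {f : Fin m → Fin n} {g : Fin m' → Fin n'} (h : m = n)
    (hf : ∀ x, (f x).val = x.val) (hg : ∀ x, (g x).val = x.val) (x : Fin (m + m')) :
    (finSumFinEquiv (sumMap f g x)).val = x.val := by
  rw [val_sumMap_eq]
  split_ifs with h1
  · rw [hf]
  · rw [hg]
    simp only
    omega

theorem val_swapEquiv (m n : ℕ) (x : Fin (m + n)) :
    (swapEquiv m n x).val = if x.val < m then n + x.val else x.val - m := by
  induction x using Fin.addCases with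
  | left x => simp [swapEquiv]
  | right x => simp [swapEquiv]

noncomputable instance : MonoidalCategory FinCospan :=
  .ofTensorHom
    (id_tensorHom_id := fun a b => tensor_id_id a.card b.card)
    (id_tensorHom := fun _ _ _ _ => rfl)
    (tensorHom_id := fun _ _ => rfl)
    (tensorHom_comp_tensorHom := fun a a' b b' => (tensor_comp a b a' b').symm)
    (associator_naturality := fun a b c => by
      obtain ⟨p, f, g, rfl⟩ := CHom.ind a
      obtain ⟨q, f', g', rfl⟩ := CHom.ind b
      obtain ⟨r, f'', g'', rfl⟩ := CHom.ind c
      change comp (tensor (tensor _ _) _) (ofFun _) = comp (ofFun _) (tensor _ (tensor _ _))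
      simp only [tensor_cls, cls_comp_ofFun, ofFun_comp_cls]
      refine cls_eq_cls (Equiv.sumAssoc _ _ _) (fun x => sumMap_assoc f f' f'' x) (fun x => ?_)
      simp only [Function.comp_apply, sumMap_assoc, Equiv.apply_symm_apply])
    (leftUnitor_naturality := fun a => by
      obtain ⟨p, f, g, rfl⟩ := CHom.ind a
      change comp (tensor (cls _ _ _) _) (ofFun _) = comp (ofFun _) _
      simp only [tensor_cls, cls_comp_ofFun, ofFun_comp_cls]
      have key : ∀ {k : ℕ} (h : Fin k → Fin p) (x : Fin (0 + k)),
          Equiv.emptySum (Fin 0) (Fin p) (sumMap (id : Fin 0 → Fin 0) h x) =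
            h (finCongr (Nat.zero_add k) x) := by
        intro k h x
        induction x using Fin.addCases with
        | left x => exact x.elim0
        | right x =>
          have : finCongr (Nat.zero_add k) (Fin.natAdd 0 x) = x := by ext; simp
          rw [this, sumMap_natAdd]; rfl
      refine cls_eq_cls (Equiv.emptySum (Fin 0) (Fin p)) (fun x => key f x) (fun x => ?_)
      refine (key g _).trans ?_
      simp only [Equiv.apply_symm_apply])
    (rightUnitor_naturality := fun a => by
      obtain ⟨p, f, g, rfl⟩ := CHom.ind a
      change comp (tensor _ (cls _ _ _)) (ofFun _) = comp (ofFun _) _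
      simp only [tensor_cls, cls_comp_ofFun, ofFun_comp_cls]
      have key : ∀ {k : ℕ} (h : Fin k → Fin p) (x : Fin (k + 0)),
          Equiv.sumEmpty (Fin p) (Fin 0) (sumMap h (id : Fin 0 → Fin 0) x) =
            h (finCongr (Nat.add_zero k) x) := by
        intro k h x
        induction x using Fin.addCases with
        | left x =>
          have : finCongr (Nat.add_zero k) (Fin.castAdd 0 x) = x := by ext; simp
          rw [this, sumMap_castAdd]; rfl
        | right x => exact x.elim0
      refine cls_eq_cls (Equiv.sumEmpty (Fin p) (Fin 0)) (fun x => key f x) (fun x => ?_)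
      refine (key g _).trans ?_
      simp only [Equiv.apply_symm_apply])
    (pentagon := fun a b c d => by
      change comp (tensor (ofFun _) (ofFun _)) (comp (ofFun _) (tensor (ofFun _) (ofFun _))) =
        comp (ofFun _) (ofFun _)
      simp only [tensor_ofFun, ofFun_comp_ofFun]
      congr 1
      funext x
      apply Fin.ext
      simp only [Function.comp_apply]
      refine (val_sumMap rfl (by intro; rfl) (by intro; rfl) _).trans ?_
      refine (val_sumMap (Nat.add_assoc _ _ _) (by intro; rfl) (by intro; rfl) x).trans ?_
      rfl)
    (triangle := fun a b => by
      change comp (ofFun _) (tensor (ofFun _) (ofFun _)) = tensor (ofFun _) (ofFun _)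
      simp only [tensor_ofFun, ofFun_comp_ofFun]
      congr 1
      funext x
      apply Fin.ext
      simp only [Function.comp_apply]
      refine (val_sumMap rfl (by intro; rfl) (by intro; rfl) _).trans ?_
      refine Eq.trans ?_ (val_sumMap (Nat.add_zero _) (by intro; rfl) (by intro; rfl) x).symm
      rfl)

theorem hexagon_fun (a b c : ℕ) (x : Fin (a + b + c)) :
    finCongr (Nat.add_assoc b c a) (swapEquiv a (b + c) (finCongr (Nat.add_assoc a b c) x)) =
      finSumFinEquiv (sumMap id (swapEquiv a c) (finCongr (Nat.add_assoc b a c)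
        (finSumFinEquiv (sumMap (swapEquiv a b) id x)))) := by
  apply Fin.ext
  have hx := x.isLt
  simp only [val_sumMap_eq, val_swapEquiv, finCongr_apply, Fin.val_cast, id_eq]
  split_ifs <;> omega

theorem hexagon_fun' (a b c : ℕ) (x : Fin (a + (b + c))) :
    (finCongr (Nat.add_assoc c a b)).symm
      (swapEquiv (a + b) c ((finCongr (Nat.add_assoc a b c)).symm x)) =
      finSumFinEquiv (sumMap (swapEquiv a c) id ((finCongr (Nat.add_assoc a c b)).symm
        (finSumFinEquiv (sumMap id (swapEquiv b c) x)))) := by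
  apply Fin.ext
  have hx := x.isLt
  simp only [val_sumMap_eq, val_swapEquiv, finCongr_apply, Fin.val_cast, finCongr_symm, id_eq]
  split_ifs <;> omega

/-- The braiding exchanges the two blocks. -/
noncomputable instance : SymmetricCategory FinCospan where
  braiding a b := isoOfEquiv (swapEquiv a.card b.card)
  braiding_naturality_right a _ _ f := by
    obtain ⟨p, f, g, rfl⟩ := CHom.ind f
    change comp (tensor (ofFun _) _) (ofFun _) = comp (ofFun _) (tensor _ (ofFun _))
    simp only [ofFun, tensor_cls]
    change comp _ (ofFun _) = comp (ofFun _) _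
    simp only [cls_comp_ofFun, ofFun_comp_cls]
    refine cls_eq_cls (Equiv.sumComm _ _) (fun x => sumMap_swap _ _ x) (fun x => ?_)
    refine (sumMap_swap _ _ _).trans ?_
    simp only [Equiv.apply_symm_apply]
  braiding_naturality_left f a := by
    obtain ⟨p, f, g, rfl⟩ := CHom.ind f
    change comp (tensor _ (ofFun _)) (ofFun _) = comp (ofFun _) (tensor (ofFun _) _)
    simp only [ofFun, tensor_cls]
    change comp _ (ofFun _) = comp (ofFun _) _
    simp only [cls_comp_ofFun, ofFun_comp_cls]
    refine cls_eq_cls (Equiv.sumComm _ _) (fun x => sumMap_swap _ _ x) (fun x => ?_)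
    refine (sumMap_swap _ _ _).trans ?_
    simp only [Equiv.apply_symm_apply]
  hexagon_forward a b c := by
    change comp (ofFun _) (comp (ofFun _) (ofFun _)) =
      comp (tensor (ofFun _) (ofFun _)) (comp (ofFun _) (tensor (ofFun _) (ofFun _)))
    simp only [tensor_ofFun, ofFun_comp_ofFun]
    congr 1
    exact funext (hexagon_fun a.card b.card c.card)
  hexagon_reverse a b c := by
    change comp (ofFun _) (comp (ofFun _) (ofFun _)) =
      comp (tensor (ofFun _) (ofFun _)) (comp (ofFun _) (tensor (ofFun _) (ofFun _)))
    simp only [tensor_ofFun, ofFun_comp_ofFun]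
    congr 1
    exact funext (hexagon_fun' a.card b.card c.card)
  symmetry a b := by
    change comp (ofFun _) (ofFun _) = ofFun id
    rw [ofFun_comp_ofFun]
    congr 1
    funext x
    simp [swapEquiv]

end FinCospan

namespace FinCospan

theorem eqToHom_eq {a b : FinCospan} (h : a = b) :
    eqToHom h = (isoOfEquiv (finCongr (congrArg card h))).hom := by
  subst h; rfl

/-- The unique cospan `Fin m → Fin 1 ← Fin n` with a one-element apex. -/
noncomputable def spider (m n : ℕ) : (⟨m⟩ : FinCospan) ⟶ ⟨n⟩ :=
  cls (Fin 1) (fun _ => 0) (fun _ => 0)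

end FinCospan

section

variable (C : Type u) [Category.{v} C] [MonoidalCategory C]

/-- A monoidal category is strict if its tensor product is associative and unital on the nose, with
identities as associators and unitors. -/
structure IsStrictMonoidal : Prop where
  associator : ∀ X Y Z : C, ∃ h : (X ⊗ Y) ⊗ Z = X ⊗ (Y ⊗ Z), (α_ X Y Z).hom = eqToHom h
  leftUnitor : ∀ X : C, ∃ h : 𝟙_ C ⊗ X = X, (λ_ X).hom = eqToHom h
  rightUnitor : ∀ X : C, ∃ h : X ⊗ 𝟙_ C = X, (ρ_ X).hom = eqToHom h

theorem FinCospan.isStrictMonoidal : IsStrictMonoidal FinCospan where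
  associator a b c :=
    ⟨congrArg FinCospan.mk (Nat.add_assoc a.card b.card c.card), (eqToHom_eq _).symm⟩
  leftUnitor a := ⟨congrArg FinCospan.mk (Nat.zero_add a.card), (eqToHom_eq _).symm⟩
  rightUnitor a := ⟨congrArg FinCospan.mk (Nat.add_zero a.card), (eqToHom_eq _).symm⟩

/-- The data `(X, μ, η, δ, ε)` underlying a Frobenius monoid. -/
structure FrobeniusData where
  X : C
  mul : X ⊗ X ⟶ X
  unit : 𝟙_ C ⟶ X
  comul : X ⟶ X ⊗ X
  counit : X ⟶ 𝟙_ C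

variable {C}

/-- The nine equations of a special commutative Frobenius monoid. -/
structure FrobeniusData.IsSpecialCommutative [BraidedCategory C] (S : FrobeniusData C) : Prop where
  assoc : S.mul ▷ S.X ≫ S.mul = (α_ S.X S.X S.X).hom ≫ S.X ◁ S.mul ≫ S.mul
  unit_mul : S.unit ▷ S.X ≫ S.mul = (λ_ S.X).hom
  comm : (β_ S.X S.X).hom ≫ S.mul = S.mul
  coassoc : S.comul ≫ S.comul ▷ S.X ≫ (α_ S.X S.X S.X).hom = S.comul ≫ S.X ◁ S.comul
  comul_counit : S.comul ≫ S.counit ▷ S.X = (λ_ S.X).inv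
  cocomm : S.comul ≫ (β_ S.X S.X).hom = S.comul
  frobenius_left : S.comul ▷ S.X ≫ (α_ S.X S.X S.X).hom ≫ S.X ◁ S.mul = S.mul ≫ S.comul
  frobenius_right : S.X ◁ S.comul ≫ (α_ S.X S.X S.X).inv ≫ S.mul ▷ S.X = S.mul ≫ S.comul
  special : S.comul ≫ S.mul = 𝟙 S.X

end

/-- A (strong) symmetric monoidal functor `(F, φ)`, with its coherence isomorphisms `φ` as data:
`ε : 𝟙_ C ⟶ F 𝟙_` and `μ : F X ⊗ F Y ⟶ F (X ⊗ Y)`, with inverses `η` and `δ`. -/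
structure SymmMonFunctor (D : Type*) [Category* D] [MonoidalCategory D] [SymmetricCategory D]
    (C : Type*) [Category* C] [MonoidalCategory C] [SymmetricCategory C] where
  toFunctor : D ⥤ C
  braided : toFunctor.Braided

namespace SymmMonFunctor

attribute [instance] braided

open CategoryTheory.Functor.LaxMonoidal CategoryTheory.Functor.OplaxMonoidal

/-- A symmetric monoidal functor is strict if it preserves unit and tensor products of objects on
the nose, and all its coherence isomorphisms are identities. -/
def IsStrict {D : Type*} [Category* D] [MonoidalCategory D] [SymmetricCategory D]
    {C : Type*} [Category* C] [MonoidalCategory C] [SymmetricCategory C]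
    (F : SymmMonFunctor D C) : Prop :=
  (∃ h : 𝟙_ C = F.toFunctor.obj (𝟙_ D), ε F.toFunctor = eqToHom h) ∧
  ∀ X Y : D, ∃ h : F.toFunctor.obj X ⊗ F.toFunctor.obj Y = F.toFunctor.obj (X ⊗ Y),
    μ F.toFunctor X Y = eqToHom h

variable {C : Type u} [Category.{v} C] [MonoidalCategory C] [SymmetricCategory C]

/-- Strictness of a symmetric monoidal functor `F` out of the cospan category when the target need
not be strict: `F` sends `m` to the left-bracketed tensor power `(⋯(X ⊗ X) ⊗ ⋯) ⊗ X` of `X = F 1`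
on the nose, that is, `F 0 = 𝟙_ C` and `F (n + 1) = F n ⊗ F 1` for `n ≥ 1`, and the corresponding
coherence isomorphisms are identities. -/
def IsPowerStrict (F : SymmMonFunctor FinCospan C) : Prop :=
  (∃ h : 𝟙_ C = F.toFunctor.obj (𝟙_ FinCospan), ε F.toFunctor = eqToHom h) ∧
  ∀ n : ℕ, 1 ≤ n →
    ∃ h : F.toFunctor.obj ⟨n⟩ ⊗ F.toFunctor.obj ⟨1⟩ =
        F.toFunctor.obj ((⟨n⟩ : FinCospan) ⊗ ⟨1⟩),
      μ F.toFunctor ⟨n⟩ ⟨1⟩ = eqToHom h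

/-- The image of the object `1` and of its four Frobenius generators, the cospans
`2 → 1 ← 1`, `0 → 1 ← 1`, `1 → 1 ← 2`, `1 → 1 ← 0`, transported along the coherence isomorphisms. -/
noncomputable def frobeniusData (F : SymmMonFunctor FinCospan C) : FrobeniusData C where
  X := F.toFunctor.obj ⟨1⟩
  mul := μ F.toFunctor ⟨1⟩ ⟨1⟩ ≫ F.toFunctor.map (FinCospan.spider 2 1)
  unit := ε F.toFunctor ≫ F.toFunctor.map (FinCospan.spider 0 1)
  comul := F.toFunctor.map (FinCospan.spider 1 2) ≫ δ F.toFunctor ⟨1⟩ ⟨1⟩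
  counit := F.toFunctor.map (FinCospan.spider 1 0) ≫ η F.toFunctor

end SymmMonFunctor

/-! For a commutative monoid `X`, the power `X^n` is the `n`-fold coproduct of `X` among commutative
monoids. So a function `Fin m → Fin n` induces a monoid morphism `X^m ⟶ X^n` (`TensorPowers.map`),
and an equation between monoid morphisms out of a power may be tested on the coprojections
(`TensorPowers.monHom_ext`); all coherence conditions become computations with indices. A
cocommutative comonoid is a commutative monoid in `Cᵒᵖ`, so the same construction gives a
contravariant action `TensorPowers.comap`. Powers are fixed only up to isomorphism (`TensorPowers`):
this makes the notion self-dual and leaves room for powers whose first one is `X` on the nose.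

A cospan with legs `f`, `g` acts by `map f ≫ comap g`. This respects composition by pushout because
of the Beck-Chevalley identity `comap g ≫ map h = map i ≫ comap j` for every pushout square
(`TensorPowers.beckChevalley`). Such squares paste, so `g` may be taken to be a bijection, a
coprojection, or the identification of two points. In the last case, if `h` identifies the same two
points the identity is the special law, and otherwise it comes from the Frobenius law. Bijections
need `comap e = map e.symm`, which reduces to the symmetry of `C` through adjacent transpositions.
The powers `𝟙_ C`, `X`, `X ⊗ X`, … then give surjectivity.

The assignment lands in special commutative Frobenius monoids because the object `1` of the cospan
category is one, and symmetric monoidal functors preserve the equations. It is injective because the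
cospan category is generated by the four Frobenius cospans and the exchange of two points under
composition and sums (`FinCospan.hom_induction`), while unitality and associativity determine every
`φ_{m,n}` from `φ_∅` and the `φ_{n,1}`. The latter fact also shows that over a strict target
strictness on powers is the same as strictness. -/

/-! ### Tensor products as coproducts of commutative monoids. -/

section CoproductOfMonoids

open MonObj

variable {C : Type u} [Category.{v} C] [MonoidalCategory C]

/-- The first coprojection `A ⟶ A ⊗ B` of a tensor product of monoids. -/
def tensorInl (A B : C) [MonObj B] : A ⟶ A ⊗ B := (ρ_ A).inv ≫ A ◁ η[B]

/-- The second coprojection `B ⟶ A ⊗ B` of a tensor product of monoids. -/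
def tensorInr (A B : C) [MonObj A] : B ⟶ A ⊗ B := (λ_ B).inv ≫ η[A] ▷ B

section Monoidal

variable {A A' B B' D T : C}

@[simp]
theorem tensorInl_whiskerLeft [MonObj B] [MonObj B'] (g : B ⟶ B') [IsMonHom g] :
    tensorInl A B ≫ A ◁ g = tensorInl A B' := by
  simp [tensorInl, ← whiskerLeft_comp]

@[simp]
theorem tensorInl_whiskerRight [MonObj B] (f : A ⟶ A') :
    tensorInl A B ≫ f ▷ B = f ≫ tensorInl A' B := by
  simp [tensorInl, whisker_exchange]

@[simp]
theorem tensorInr_whiskerRight [MonObj A] [MonObj A'] (f : A ⟶ A') [IsMonHom f] :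
    tensorInr A B ≫ f ▷ B = tensorInr A' B := by
  simp [tensorInr, ← comp_whiskerRight]

@[simp]
theorem tensorInr_whiskerLeft [MonObj A] (g : B ⟶ B') :
    tensorInr A B ≫ A ◁ g = g ≫ tensorInr A B' := by
  simp [tensorInr, ← whisker_exchange]

@[simp]
theorem tensorInl_tensorHom [MonObj B] [MonObj B'] (f : A ⟶ A') (g : B ⟶ B') [IsMonHom g] :
    tensorInl A B ≫ (f ⊗ₘ g) = f ≫ tensorInl A' B' := by
  rw [MonoidalCategory.tensorHom_def, ← Category.assoc, tensorInl_whiskerRight, Category.assoc,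
    tensorInl_whiskerLeft]

@[simp]
theorem tensorInr_tensorHom [MonObj A] [MonObj A'] (f : A ⟶ A') (g : B ⟶ B') [IsMonHom f] :
    tensorInr A B ≫ (f ⊗ₘ g) = g ≫ tensorInr A' B' := by
  rw [MonoidalCategory.tensorHom_def, ← Category.assoc, tensorInr_whiskerRight,
    tensorInr_whiskerLeft]

@[simp]
theorem tensorInl_mul [MonObj A] : tensorInl A A ≫ μ[A] = 𝟙 A := by simp [tensorInl]

@[simp]
theorem tensorInr_mul [MonObj A] : tensorInr A A ≫ μ[A] = 𝟙 A := by simp [tensorInr]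

@[simp]
theorem tensorInl_rightUnitor : tensorInl A (𝟙_ C) ≫ (ρ_ A).hom = 𝟙 A := by simp [tensorInl]

@[simp]
theorem tensorInr_leftUnitor : tensorInr (𝟙_ C) A ≫ (λ_ A).hom = 𝟙 A := by simp [tensorInr]

-- The two units are inserted on opposite sides of `B`, so the interchange law lets them pass each
-- other; the rest is coherence. No braiding is involved.
@[simp]
theorem tensorInl_tensorInr_associator_inv [MonObj A] [MonObj D] :
    tensorInl B D ≫ tensorInr A (B ⊗ D) ≫ (α_ A B D).inv =
      tensorInr A B ≫ tensorInl (A ⊗ B) D := by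
  have : (ρ_ B).inv ≫ B ◁ η[D] ≫ (λ_ _).inv ≫ η[A] ▷ (B ⊗ D) ≫ (α_ A B D).inv =
    (ρ_ B).inv ≫ (λ_ _).inv ≫ (𝟙_ C ◁ B ◁ η[D] ≫ η[A] ▷ (B ⊗ D)) ≫ (α_ A B D).inv := by
    monoidal
  simp only [tensorInl, tensorInr, Category.assoc]
  rw [this, whisker_exchange]
  monoidal

@[simp]
theorem tensorInr_tensorInl_associator [MonObj A] [MonObj D] :
    tensorInr A B ≫ tensorInl (A ⊗ B) D ≫ (α_ A B D).hom =
      tensorInl B D ≫ tensorInr A (B ⊗ D) := by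
  rw [← Category.assoc, ← tensorInl_tensorInr_associator_inv]
  simp only [Category.assoc, Iso.inv_hom_id, Category.comp_id]

end Monoidal

section Braided

variable [BraidedCategory C]
variable {A A' B B' D T : C}

@[simp]
theorem tensorInl_associator_inv [MonObj B] [MonObj D] :
    tensorInl A (B ⊗ D) ≫ (α_ A B D).inv = tensorInl A B ≫ tensorInl (A ⊗ B) D := by
  simp only [tensorInl, tensorObj.one_def, MonoidalCategory.tensorHom_def]
  monoidal

@[simp]
theorem tensorInr_tensorInr_associator_inv [MonObj A] [MonObj B] :
    tensorInr B D ≫ tensorInr A (B ⊗ D) ≫ (α_ A B D).inv = tensorInr (A ⊗ B) D := by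
  have : (λ_ D).inv ≫ η[B] ▷ D ≫ (λ_ _).inv ≫ η[A] ▷ (B ⊗ D) ≫ (α_ A B D).inv =
    (λ_ D).inv ≫ (λ_ _).inv ≫ (𝟙_ C ◁ η[B] ▷ D ≫ η[A] ▷ (B ⊗ D)) ≫ (α_ A B D).inv := by
    monoidal
  simp only [tensorInr, Category.assoc]
  rw [this, whisker_exchange, tensorObj.one_def, MonoidalCategory.tensorHom_def]
  monoidal

@[simp]
theorem tensorInl_tensorInl_associator [MonObj B] [MonObj D] :
    tensorInl A B ≫ tensorInl (A ⊗ B) D ≫ (α_ A B D).hom = tensorInl A (B ⊗ D) := by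
  rw [← Category.assoc, ← tensorInl_associator_inv, Category.assoc, Iso.inv_hom_id,
    Category.comp_id]

@[simp]
theorem tensorInr_associator [MonObj A] [MonObj B] :
    tensorInr (A ⊗ B) D ≫ (α_ A B D).hom = tensorInr B D ≫ tensorInr A (B ⊗ D) := by
  rw [← tensorInr_tensorInr_associator_inv]
  simp only [Category.assoc, Iso.inv_hom_id, Category.comp_id]

@[simp]
theorem tensorInl_braiding [MonObj B] : tensorInl A B ≫ (β_ A B).hom = tensorInr B A := by
  simp [tensorInl, tensorInr]

@[simp]
theorem tensorInr_braiding [MonObj A] : tensorInr A B ≫ (β_ A B).hom = tensorInl B A := by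
  simp [tensorInl, tensorInr]

/-- In elements, `(a ⊗ 1)(1 ⊗ b) = a ⊗ b`. The braiding inside the product of `A ⊗ B` only exchanges
two copies of the unit object, so it disappears. -/
theorem tensorInl_tensorInr_mul (A B : C) [MonObj A] [MonObj B] :
    (tensorInl A B ⊗ₘ tensorInr A B) ≫ μ[A ⊗ B] = 𝟙 (A ⊗ B) := by
  have h : ((ρ_ A).inv ⊗ₘ (λ_ B).inv) ≫ tensorμ A (𝟙_ C) (𝟙_ C) B =
      (ρ_ A).inv ⊗ₘ (λ_ B).inv := by
    rw [tensorμ, braiding_tensorUnit_left]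
    monoidal
  have h₁ : A ◁ η[A] ≫ μ[A] = (ρ_ A).hom := MonObj.mul_one A
  have h₂ : η[B] ▷ B ≫ μ[B] = (λ_ B).hom := MonObj.one_mul B
  rw [tensorInl, tensorInr, ← id_tensorHom, ← tensorHom_id, ← tensorHom_comp_tensorHom,
    Category.assoc, tensorObj.mul_def, tensorμ_natural_assoc, reassoc_of% h,
    tensorHom_comp_tensorHom, tensorHom_comp_tensorHom, id_tensorHom, tensorHom_id, h₁, h₂,
    Iso.inv_hom_id, Iso.inv_hom_id, id_tensorHom_id]

/-- Morphisms of monoids out of a tensor product are determined by their restrictions along the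
two coprojections. -/
theorem tensor_monHom_ext [MonObj A] [MonObj B] [MonObj T] {f g : A ⊗ B ⟶ T} [IsMonHom f]
    [IsMonHom g]
    (hl : tensorInl A B ≫ f = tensorInl A B ≫ g) (hr : tensorInr A B ≫ f = tensorInr A B ≫ g) :
    f = g := by
  -- In elements, `k(a ⊗ b) = k(a ⊗ 1) k(1 ⊗ b)`.
  have key (k : A ⊗ B ⟶ T) [IsMonHom k] :
      k = ((tensorInl A B ≫ k) ⊗ₘ (tensorInr A B ≫ k)) ≫ μ[T] := by
    rw [← tensorHom_comp_tensorHom, Category.assoc, ← IsMonHom.mul_hom, ← Category.assoc,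
      tensorInl_tensorInr_mul, Category.id_comp]
  rw [key f, key g, hl, hr]

/-- The multiplication of a commutative monoid is a morphism of monoids. -/
instance isMonHom_mul [MonObj A] [IsCommMonObj A] : IsMonHom μ[A] where
  one_hom := by simp [tensorObj.one_def, ← unitors_equal]
  mul_hom := by simp [tensorObj.mul_def]

instance isMonHom_one [MonObj A] : IsMonHom η[A] where
  one_hom := by simp
  mul_hom := by simp [MonoidalCategory.tensorHom_def, unitors_equal]

end Braided

end CoproductOfMonoids

/-! ### Tensor powers of a commutative monoid and the covariant action of functions. -/

/-- A choice of left-bracketed tensor powers of an object. -/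
structure TensorPowers {C : Type u} [Category.{v} C] [MonoidalCategory C] (X : C) where
  obj : ℕ → C
  zero : 𝟙_ C ≅ obj 0
  succ (n : ℕ) : obj n ⊗ X ≅ obj (n + 1)

namespace TensorPowers

open MonObj

section Tensorator

variable {C : Type u} [Category.{v} C] [MonoidalCategory C] {X : C} (T : TensorPowers X)

/-- The canonical isomorphism between a tensor product of tensor powers and a tensor power. -/
def tensorIso (m : ℕ) : (n : ℕ) → (T.obj m ⊗ T.obj n ≅ T.obj (m + n))
  | 0 => whiskerLeftIso (T.obj m) T.zero.symm ≪≫ ρ_ (T.obj m)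
  | n + 1 => whiskerLeftIso (T.obj m) (T.succ n).symm ≪≫ (α_ (T.obj m) (T.obj n) X).symm ≪≫
      whiskerRightIso (tensorIso m n) X ≪≫ T.succ (m + n)

theorem tensorIso_zero_hom (m : ℕ) :
    (T.tensorIso m 0).hom = T.obj m ◁ T.zero.inv ≫ (ρ_ (T.obj m)).hom := rfl

theorem tensorIso_succ_hom (m n : ℕ) :
    (T.tensorIso m (n + 1)).hom = T.obj m ◁ (T.succ n).inv ≫ (α_ (T.obj m) (T.obj n) X).inv ≫
      (T.tensorIso m n).hom ▷ X ≫ (T.succ (m + n)).hom := rfl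

/-- The same tensor powers in the opposite category. -/
protected def op : TensorPowers (Opposite.op X) where
  obj n := Opposite.op (T.obj n)
  zero := T.zero.symm.op
  succ n := (T.succ n).symm.op

/-- This is what lets each statement on `map`, read in `Cᵒᵖ`, become a statement on `comap` with the
same isomorphisms `tensorIso`. -/
theorem op_tensorIso_hom (m n : ℕ) : (T.op.tensorIso m n).hom = (T.tensorIso m n).inv.op := by
  induction n with
  | zero => rfl
  | succ n ih =>
    rw [tensorIso_succ_hom, ih]
    apply Quiver.Hom.unop_inj
    simp [tensorIso, TensorPowers.op]

end Tensorator

variable {C : Type u} [Category.{v} C] [MonoidalCategory C] [SymmetricCategory C] {X : C}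
  [MonObj X] (T : TensorPowers X)

/-- Tensor powers of a monoid are monoids. -/
instance monObj : (n : ℕ) → MonObj (T.obj n)
  | 0 => .ofIso T.zero
  | n + 1 => letI := monObj n; .ofIso (T.succ n)

instance isMonHom_zero_hom : IsMonHom T.zero.hom := isMonHom_ofIso T.zero

instance isMonHom_succ_hom (n : ℕ) : IsMonHom (T.succ n).hom := isMonHom_ofIso (T.succ n)

theorem isCommMonObj_of_iso {A B : C} [MonObj A] [MonObj B] [IsCommMonObj A] (e : A ≅ B)
    [IsMonHom e.hom] : IsCommMonObj B where
  mul_comm := by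
    have h : μ[B] = (e.inv ⊗ₘ e.inv) ≫ μ[A] ≫ e.hom := by simp
    rw [h, ← BraidedCategory.braiding_naturality_assoc, IsCommMonObj.mul_comm_assoc]

instance isCommMonObj [IsCommMonObj X] : (n : ℕ) → IsCommMonObj (T.obj n)
  | 0 => isCommMonObj_of_iso T.zero
  | n + 1 => letI := isCommMonObj n; isCommMonObj_of_iso (T.succ n)

/-- The coprojections of a monoid into its tensor powers. -/
def inj : {n : ℕ} → Fin n → (X ⟶ T.obj n)
  | 0, i => i.elim0
  | n + 1, i => Fin.lastCases (tensorInr (T.obj n) X ≫ (T.succ n).hom)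
      (fun i => inj i ≫ tensorInl (T.obj n) X ≫ (T.succ n).hom) i

@[simp]
theorem inj_last (n : ℕ) : T.inj (Fin.last n) = tensorInr (T.obj n) X ≫ (T.succ n).hom := by
  simp [inj]

@[simp]
theorem inj_castSucc {n : ℕ} (i : Fin n) :
    T.inj i.castSucc = T.inj i ≫ tensorInl (T.obj n) X ≫ (T.succ n).hom := by
  simp [inj]

/-- The morphism out of a tensor power with given restrictions along the coprojections. -/
def desc {A : C} [MonObj A] : {m : ℕ} → (Fin m → (X ⟶ A)) → (T.obj m ⟶ A)
  | 0, _ => T.zero.inv ≫ η[A]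
  | m + 1, u => (T.succ m).inv ≫ (desc (fun i => u i.castSucc) ⊗ₘ u (Fin.last m)) ≫ μ[A]

instance tensorInl_isMonHom {A B : C} [MonObj A] [MonObj B] : IsMonHom (tensorInl A B) := by
  unfold tensorInl; infer_instance

instance tensorInr_isMonHom {A B : C} [MonObj A] [MonObj B] : IsMonHom (tensorInr A B) := by
  unfold tensorInr; infer_instance

instance inj_isMonHom : {n : ℕ} → (i : Fin n) → IsMonHom (T.inj i)
  | 0, i => i.elim0
  | n + 1, i => by
    induction i using Fin.lastCases with
    | last => rw [inj_last]; infer_instance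
    | cast i => have := inj_isMonHom i; rw [inj_castSucc]; infer_instance

/-- The multiplication of `A` is itself a monoid morphism because `A` is commutative. -/
theorem desc_isMonHom {A : C} [MonObj A] [IsCommMonObj A] : {m : ℕ} → (u : Fin m → (X ⟶ A)) →
    [∀ i, IsMonHom (u i)] → IsMonHom (T.desc u)
  | 0, _, _ => by unfold desc; infer_instance
  | m + 1, u, _ => by
    have := desc_isMonHom (fun i => u i.castSucc)
    unfold desc; infer_instance

theorem inj_desc {A : C} [MonObj A] [IsCommMonObj A] : {m : ℕ} → (u : Fin m → (X ⟶ A)) →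
    [∀ i, IsMonHom (u i)] → (i : Fin m) → T.inj i ≫ T.desc u = u i
  | 0, _, _, i => i.elim0
  | m + 1, u, _, i => by
    have := T.desc_isMonHom (fun i => u i.castSucc)
    induction i using Fin.lastCases with
    | last =>
      rw [inj_last, desc, Category.assoc, Iso.hom_inv_id_assoc, ← Category.assoc,
        tensorInr_tensorHom, Category.assoc, tensorInr_mul, Category.comp_id]
    | cast i =>
      rw [inj_castSucc, desc, Category.assoc, Category.assoc, Iso.hom_inv_id_assoc,
        reassoc_of% @tensorInl_tensorHom C, tensorInl_mul, Category.comp_id]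
      exact inj_desc _ i

/-- Morphisms of monoids out of a tensor power are determined by their restrictions along the
coprojections. -/
theorem monHom_ext {A : C} [MonObj A] : {m : ℕ} → {f g : T.obj m ⟶ A} → [IsMonHom f] →
    [IsMonHom g] → (∀ i, T.inj i ≫ f = T.inj i ≫ g) → f = g
  | 0, f, g, _, _, _ => by
    have h (k : T.obj 0 ⟶ A) [IsMonHom k] : k = T.zero.inv ≫ η[A] := by
      have : T.zero.hom ≫ k = η[𝟙_ C] ≫ T.zero.hom ≫ k := by simp
      rw [Iso.eq_inv_comp, this, IsMonHom.one_hom]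
    rw [h f, h g]
  | m + 1, f, g, _, _, h => by
    rw [← cancel_epi (T.succ m).hom]
    apply tensor_monHom_ext
    · apply monHom_ext
      intro i
      simpa using h i.castSucc
    · simpa using h (Fin.last m)

instance tensorIso_isMonHom (m : ℕ) : (n : ℕ) → IsMonHom (T.tensorIso m n).hom
  | 0 => by rw [tensorIso_zero_hom]; infer_instance
  | n + 1 => by
    have := tensorIso_isMonHom m n
    have : IsMonHom (α_ (T.obj m) (T.obj n) X).symm.hom :=
      inferInstanceAs (IsMonHom (α_ (T.obj m) (T.obj n) X).inv)
    rw [tensorIso_succ_hom]; infer_instance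

/-- With `inj_tensorInr_tensorIso`, this describes `tensorIso` on all coprojections, so later
identities reduce to equalities of indices. -/
theorem inj_tensorInl_tensorIso {m : ℕ} (i : Fin m) : (n : ℕ) →
    T.inj i ≫ tensorInl (T.obj m) (T.obj n) ≫ (T.tensorIso m n).hom = T.inj (Fin.castAdd n i)
  | 0 => by
    rw [tensorIso_zero_hom, reassoc_of% @tensorInl_whiskerLeft C, tensorInl_rightUnitor,
      Category.comp_id]
    rfl
  | n + 1 => by
    have ih := inj_tensorInl_tensorIso i n
    rw [tensorIso_succ_hom, reassoc_of% @tensorInl_whiskerLeft C,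
      reassoc_of% @tensorInl_associator_inv C, reassoc_of% @tensorInl_whiskerRight C,
      reassoc_of% ih]
    exact (T.inj_castSucc _).symm

theorem inj_tensorInr_tensorIso (m : ℕ) : {n : ℕ} → (i : Fin n) →
    T.inj i ≫ tensorInr (T.obj m) (T.obj n) ≫ (T.tensorIso m n).hom = T.inj (Fin.natAdd m i)
  | 0, i => i.elim0
  | n + 1, i => by
    rw [tensorIso_succ_hom, reassoc_of% @tensorInr_whiskerLeft C]
    induction i using Fin.lastCases with
    | last =>
      rw [inj_last, Category.assoc, Iso.hom_inv_id_assoc,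
        reassoc_of% @tensorInr_tensorInr_associator_inv C, reassoc_of% @tensorInr_whiskerRight C]
      exact (T.inj_last _).symm
    | cast i =>
      have ih := inj_tensorInr_tensorIso m i
      rw [inj_castSucc, Category.assoc, Category.assoc, Iso.hom_inv_id_assoc,
        reassoc_of% @tensorInl_tensorInr_associator_inv C,
        reassoc_of% @tensorInl_whiskerRight C, reassoc_of% ih]
      exact (T.inj_castSucc _).symm

theorem tensor_monHom_ext {A : C} [MonObj A] {m n : ℕ} {f g : T.obj m ⊗ T.obj n ⟶ A} [IsMonHom f]
    [IsMonHom g] (hl : ∀ i, T.inj i ≫ tensorInl (T.obj m) (T.obj n) ≫ f =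
      T.inj i ≫ tensorInl (T.obj m) (T.obj n) ≫ g)
    (hr : ∀ i, T.inj i ≫ tensorInr (T.obj m) (T.obj n) ≫ f =
      T.inj i ≫ tensorInr (T.obj m) (T.obj n) ≫ g) : f = g :=
  _root_.tensor_monHom_ext (T.monHom_ext hl) (T.monHom_ext hr)

variable [IsCommMonObj X]

/-- The morphism of tensor powers of a commutative monoid given by a function. -/
def map {m n : ℕ} (f : Fin m → Fin n) : T.obj m ⟶ T.obj n := T.desc (fun i => T.inj (f i))

instance map_isMonHom {m n : ℕ} (f : Fin m → Fin n) : IsMonHom (T.map f) := T.desc_isMonHom _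

@[simp]
theorem inj_map {m n : ℕ} (f : Fin m → Fin n) (i : Fin m) :
    T.inj i ≫ T.map f = T.inj (f i) := T.inj_desc _ i

@[simp]
theorem map_id (m : ℕ) : T.map (id : Fin m → Fin m) = 𝟙 _ := T.monHom_ext (by simp)

theorem map_comp {m n k : ℕ} (f : Fin m → Fin n) (g : Fin n → Fin k) :
    T.map (g ∘ f) = T.map f ≫ T.map g :=
  T.monHom_ext (fun i => by rw [← Category.assoc]; simp)

theorem inj_map_assoc {m n : ℕ} (f : Fin m → Fin n) (i : Fin m) {A : C} (g : T.obj n ⟶ A) :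
    T.inj i ≫ T.map f ≫ g = T.inj (f i) ≫ g := by
  rw [← Category.assoc, inj_map]

/-- Both sides are monoid morphisms, hence may be compared on coprojections. Associativity, left
unitality and the braiding below are proved by the same method. -/
theorem tensorIso_natural {m n m' n' : ℕ} (f : Fin m → Fin n) (g : Fin m' → Fin n') :
    (T.map f ⊗ₘ T.map g) ≫ (T.tensorIso n n').hom =
      (T.tensorIso m m').hom ≫ T.map (finSumFinEquiv ∘ FinCospan.sumMap f g) := by
  apply T.tensor_monHom_ext <;> intro i
  · rw [reassoc_of% @tensorInl_tensorHom C, inj_map_assoc, inj_tensorInl_tensorIso,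
      reassoc_of% T.inj_tensorInl_tensorIso i, inj_map]
    simp
  · rw [reassoc_of% @tensorInr_tensorHom C, inj_map_assoc, inj_tensorInr_tensorIso,
      reassoc_of% T.inj_tensorInr_tensorIso m i, inj_map]
    simp

theorem tensorIso_assoc (m n k : ℕ) :
    (T.tensorIso m n).hom ▷ T.obj k ≫ (T.tensorIso (m + n) k).hom ≫
        T.map (finCongr (Nat.add_assoc m n k)) =
      (α_ (T.obj m) (T.obj n) (T.obj k)).hom ≫ T.obj m ◁ (T.tensorIso n k).hom ≫
        (T.tensorIso m (n + k)).hom := by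
  apply _root_.tensor_monHom_ext
  · apply T.tensor_monHom_ext <;> intro i
    · rw [reassoc_of% @tensorInl_whiskerRight C, reassoc_of% T.inj_tensorInl_tensorIso i,
        reassoc_of% T.inj_tensorInl_tensorIso, inj_map,
        reassoc_of% @tensorInl_tensorInl_associator C, reassoc_of% @tensorInl_whiskerLeft C,
        T.inj_tensorInl_tensorIso i]
      congr 1
    · rw [reassoc_of% @tensorInl_whiskerRight C, reassoc_of% T.inj_tensorInr_tensorIso m i,
        reassoc_of% T.inj_tensorInl_tensorIso, inj_map,
        reassoc_of% @tensorInr_tensorInl_associator C, reassoc_of% @tensorInr_whiskerLeft C,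
        reassoc_of% T.inj_tensorInl_tensorIso i, T.inj_tensorInr_tensorIso m]
      congr 1
  · apply T.monHom_ext
    intro i
    rw [reassoc_of% @tensorInr_whiskerRight C, reassoc_of% T.inj_tensorInr_tensorIso _ i, inj_map,
      reassoc_of% @tensorInr_associator C, reassoc_of% @tensorInr_whiskerLeft C,
      reassoc_of% T.inj_tensorInr_tensorIso n i, T.inj_tensorInr_tensorIso m]
    congr 1
    ext
    simp [Nat.add_assoc]

theorem tensorIso_left_unitality (n : ℕ) :
    (λ_ (T.obj n)).hom =
      T.zero.hom ▷ T.obj n ≫ (T.tensorIso 0 n).hom ≫ T.map (finCongr (Nat.zero_add n)) := by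
  -- Replacing the unit object by the zeroth power makes the source a product of powers; its left
  -- factor has no coprojections to check.
  rw [← cancel_epi (T.zero.inv ▷ T.obj n)]
  apply T.tensor_monHom_ext <;> intro i
  · exact i.elim0
  · rw [reassoc_of% @tensorInr_whiskerRight C, reassoc_of% @tensorInr_whiskerRight C,
      tensorInr_leftUnitor, Category.comp_id, reassoc_of% @tensorInr_whiskerRight C,
      reassoc_of% T.inj_tensorInr_tensorIso 0 i, inj_map]
    congr 1
    ext
    simp

theorem tensorIso_right_unitality (n : ℕ) :
    (ρ_ (T.obj n)).hom =
      T.obj n ◁ T.zero.hom ≫ (T.tensorIso n 0).hom ≫ T.map (finCongr (Nat.add_zero n)) := by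
  -- `n + 0` is `n` by definition, so this re-indexing is the identity function.
  have : T.map (finCongr (Nat.add_zero n)) = 𝟙 _ := T.map_id n
  rw [this, tensorIso_zero_hom]
  simp

theorem tensorIso_braided (m n : ℕ) :
    (T.tensorIso m n).hom ≫ T.map (FinCospan.swapEquiv m n) =
      (β_ (T.obj m) (T.obj n)).hom ≫ (T.tensorIso n m).hom := by
  apply T.tensor_monHom_ext <;> intro i
  · rw [reassoc_of% @tensorInl_braiding C, reassoc_of% T.inj_tensorInl_tensorIso i, inj_map,
      T.inj_tensorInr_tensorIso]
    congr 1
    ext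
    simp [FinCospan.val_swapEquiv]
  · rw [reassoc_of% @tensorInr_braiding C, reassoc_of% T.inj_tensorInr_tensorIso _ i, inj_map,
      T.inj_tensorInl_tensorIso]
    congr 1
    ext
    simp [FinCospan.val_swapEquiv]

end TensorPowers

/-! ### The contravariant action, and its interplay with the covariant one. -/

/-- Allows the results on commutative monoids to be applied to comonoids, seen as monoids in `Cᵒᵖ`.
-/
instance symmetricCategoryOpposite {C : Type u} [Category.{v} C] [MonoidalCategory C]
    [SymmetricCategory C] : SymmetricCategory Cᵒᵖ where
  symmetry X Y := Quiver.Hom.unop_inj (by simp)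

open MonObj Opposite in
/-- A monoid and comonoid, the latter given as a monoid in the opposite category, that satisfies
the Frobenius law and is special. -/
class IsSpecialFrobenius {C : Type u} [Category.{v} C] [MonoidalCategory C] (X : C) [MonObj X]
    [MonObj (op X)] : Prop where
  frobenius : μ[op X].unop ▷ X ≫ (α_ X X X).hom ≫ X ◁ μ[X] = μ[X] ≫ μ[op X].unop
  special : μ[op X].unop ≫ μ[X] = 𝟙 X

namespace TensorPowers

open MonObj

variable {C : Type u} [Category.{v} C] [MonoidalCategory C] {X : C}

/-- The canonical isomorphism between an object and its first tensor power. -/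
def oneIso (T : TensorPowers X) : X ≅ T.obj 1 :=
  (λ_ X).symm ≪≫ whiskerRightIso T.zero X ≪≫ T.succ 0

theorem op_oneIso_hom (T : TensorPowers X) : T.op.oneIso.hom = T.oneIso.inv.op := by
  apply Quiver.Hom.unop_inj
  simp [oneIso, TensorPowers.op]

variable [SymmetricCategory C]

theorem one_obj_zero [MonObj X] (T : TensorPowers X) : η[T.obj 0] = T.zero.hom := by
  simpa using (IsMonHom.one_hom T.zero.hom).symm

theorem oneIso_hom [MonObj X] (T : TensorPowers X) : T.oneIso.hom = T.inj (0 : Fin 1) := by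
  refine Eq.trans ?_ (T.inj_last 0).symm
  rw [tensorInr, one_obj_zero, Category.assoc]
  rfl

instance [MonObj X] (T : TensorPowers X) : IsMonHom T.oneIso.hom := by
  rw [oneIso_hom]; infer_instance

theorem zero_map [MonObj X] [IsCommMonObj X] (T : TensorPowers X) (f : Fin 0 → Fin 1) :
    T.zero.hom ≫ T.map f = η[X] ≫ T.oneIso.hom := by
  rw [← one_obj_zero, IsMonHom.one_hom, IsMonHom.one_hom]

/-- Identifies the action of the function `2 → 1` with the multiplication of `X`. Both sides are
monoid morphisms, and on either coprojection both restrict to `oneIso`. -/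
theorem oneIso_map [MonObj X] [IsCommMonObj X] (T : TensorPowers X) (f : Fin 2 → Fin 1) :
    (T.oneIso.hom ⊗ₘ T.oneIso.hom) ≫ (T.tensorIso 1 1).hom ≫ T.map f =
      μ[X] ≫ T.oneIso.hom := by
  apply _root_.tensor_monHom_ext
  · rw [reassoc_of% @tensorInl_tensorHom C, reassoc_of% @tensorInl_mul C, oneIso_hom,
      reassoc_of% T.inj_tensorInl_tensorIso, inj_map, Subsingleton.elim (f _) 0]
  · rw [reassoc_of% @tensorInr_tensorHom C, reassoc_of% @tensorInr_mul C, oneIso_hom,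
      reassoc_of% T.inj_tensorInr_tensorIso, inj_map, Subsingleton.elim (f _) 0]

section Comul

open Opposite

variable [MonObj (op X)] [IsCommMonObj (op X)] (T : TensorPowers X)

/-- The morphism of tensor powers of a cocommutative comonoid given by a function. -/
def comap {m n : ℕ} (f : Fin m → Fin n) : T.obj n ⟶ T.obj m := (T.op.map f).unop

@[simp]
theorem comap_id (m : ℕ) : T.comap (id : Fin m → Fin m) = 𝟙 _ :=
  congrArg Quiver.Hom.unop (T.op.map_id m)

theorem comap_comp {m n k : ℕ} (f : Fin m → Fin n) (g : Fin n → Fin k) :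
    T.comap (g ∘ f) = T.comap g ≫ T.comap f :=
  congrArg Quiver.Hom.unop (T.op.map_comp f g)

theorem comap_natural {m n m' n' : ℕ} (f : Fin m → Fin n) (g : Fin m' → Fin n') :
    (T.comap f ⊗ₘ T.comap g) ≫ (T.tensorIso m m').hom =
      (T.tensorIso n n').hom ≫ T.comap (finSumFinEquiv ∘ FinCospan.sumMap f g) := by
  have h := congrArg Quiver.Hom.unop (T.op.tensorIso_natural f g)
  rw [op_tensorIso_hom, op_tensorIso_hom] at h
  rw [← Iso.eq_comp_inv, Category.assoc, ← Iso.inv_comp_eq]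
  exact h

theorem comap_braided (m n : ℕ) :
    T.comap (FinCospan.swapEquiv m n) ≫ (T.tensorIso m n).inv =
      (T.tensorIso n m).inv ≫ (β_ (T.obj n) (T.obj m)).hom := by
  have h := congrArg Quiver.Hom.unop (T.op.tensorIso_braided m n)
  rw [op_tensorIso_hom, op_tensorIso_hom] at h
  exact h

theorem comap_zero (f : Fin 0 → Fin 1) :
    T.comap f ≫ T.zero.inv = T.oneIso.inv ≫ η[op X].unop := by
  have h := congrArg Quiver.Hom.unop (T.op.zero_map f)
  rw [op_oneIso_hom] at h
  exact h

theorem oneIso_comap (f : Fin 2 → Fin 1) :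
    T.oneIso.hom ≫ T.comap f =
      μ[op X].unop ≫ (T.oneIso.hom ⊗ₘ T.oneIso.hom) ≫ (T.tensorIso 1 1).hom := by
  have h := congrArg Quiver.Hom.unop (T.op.oneIso_map f)
  rw [op_tensorIso_hom, op_oneIso_hom] at h
  have h' : T.comap f ≫ (T.tensorIso 1 1).inv ≫ (T.oneIso.inv ⊗ₘ T.oneIso.inv) =
      T.oneIso.inv ≫ μ[op X].unop := by
    rw [← Category.assoc]
    exact h
  rw [← Iso.eq_inv_comp, ← reassoc_of% h', tensorHom_comp_tensorHom_assoc]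
  simp

variable [MonObj X] [IsCommMonObj X]

theorem comap_sum_eq_map {m n m' n' : ℕ} {f : Fin m → Fin n} {f' : Fin m' → Fin n'}
    {g : Fin n → Fin m} {g' : Fin n' → Fin m'} (h : T.comap f = T.map g)
    (h' : T.comap f' = T.map g') :
    T.comap (finSumFinEquiv ∘ FinCospan.sumMap f f') =
      T.map (finSumFinEquiv ∘ FinCospan.sumMap g g') := by
  rw [← cancel_epi (T.tensorIso n n').hom, ← comap_natural, ← tensorIso_natural, h, h']

/-- Both sides are the braiding of the two powers, conjugated by `tensorIso`. -/
theorem comap_swapEquiv (m n : ℕ) :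
    T.comap (FinCospan.swapEquiv m n) = T.map (FinCospan.swapEquiv n m) := by
  rw [← cancel_epi (T.tensorIso n m).hom, tensorIso_braided, ← cancel_mono (T.tensorIso m n).inv,
    Category.assoc, comap_braided]
  simp

/-- The exchange of the last two points is the sum of an identity and the exchange of `1 + 1`; any
other adjacent transposition is the sum of a smaller one and the identity of a point. -/
theorem comap_adjacent_swap : (n : ℕ) → (i : Fin n) →
    T.comap (Equiv.swap i.castSucc i.succ) = T.map (Equiv.swap i.castSucc i.succ)
  | 0, i => i.elim0
  | n + 1, i => by
    induction i using Fin.lastCases with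
    | last =>
      have h := T.comap_sum_eq_map (f := (id : Fin n → Fin n)) (g := id) (by simp)
        (T.comap_swapEquiv 1 1)
      convert h using 2 <;>
      · ext x
        rw [Function.comp_apply, FinCospan.val_sumMap_eq]
        simp only [FinCospan.val_swapEquiv, Equiv.swap_apply_def, Fin.ext_iff, id]
        have := x.isLt
        split_ifs <;> simp at * <;> omega
    | cast i =>
      have h := T.comap_sum_eq_map (comap_adjacent_swap n i)
        (f' := (id : Fin 1 → Fin 1)) (g' := id) (by simp)
      convert h using 2 <;>
      · ext x
        rw [Function.comp_apply, FinCospan.val_sumMap_eq]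
        simp only [Equiv.swap_apply_def, Fin.ext_iff, id]
        have := x.isLt
        split_ifs <;> simp at * <;> omega

/-- The two actions come from unrelated structures, comonoid and monoid, so this needs proof:
adjacent transpositions generate the symmetric group, and for them it is a matter of the braiding
alone. -/
theorem comap_perm {n : ℕ} (e : Equiv.Perm (Fin n)) : T.comap e = T.map e.symm := by
  cases n with
  | zero => rw [Subsingleton.elim e 1]; exact (T.comap_id 0).trans (T.map_id 0).symm
  | succ n =>
    have he : e ∈ Submonoid.closure (Set.range fun i : Fin n ↦ Equiv.swap i.castSucc i.succ) := by
      rw [Equiv.Perm.mclosure_swap_castSucc_succ]; trivial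
    induction he using Submonoid.closure_induction with
    | mem e h =>
      obtain ⟨i, rfl⟩ := h
      rw [Equiv.symm_swap]
      exact T.comap_adjacent_swap n i
    | one => exact (T.comap_id _).trans (T.map_id _).symm
    | mul e e' _ _ h h' =>
      rw [show (⇑(e * e') : Fin (n + 1) → Fin (n + 1)) = e ∘ e' from rfl, comap_comp, h, h',
        ← map_comp]
      rfl

theorem comap_equiv {m n : ℕ} (e : Fin m ≃ Fin n) : T.comap e = T.map e.symm := by
  obtain rfl : m = n := by simpa using Fintype.card_congr e
  exact T.comap_perm e

theorem comap_comp_map_fold [IsSpecialFrobenius X] (f : Fin 2 → Fin 1) :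
    T.comap f ≫ T.map f = 𝟙 _ := by
  rw [← cancel_epi T.oneIso.hom, reassoc_of% T.oneIso_comap f, T.oneIso_map f,
    reassoc_of% IsSpecialFrobenius.special (X := X), Category.comp_id]

/-- The Frobenius law of `X`, transported along `oneIso` and `tensorIso`. -/
theorem frobenius [IsSpecialFrobenius X] (f : Fin 2 → Fin 1) :
    T.comap (finSumFinEquiv ∘ FinCospan.sumMap f id : Fin (2 + 1) → Fin (1 + 1)) ≫
        T.map (finSumFinEquiv ∘ FinCospan.sumMap id f : Fin (1 + 2) → Fin (1 + 1)) =
      T.map f ≫ T.comap f := by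
  have hm := T.oneIso_map f
  have hc : T.oneIso.hom ≫ T.comap f ≫ (T.tensorIso 1 1).inv =
      μ[op X].unop ≫ (T.oneIso.hom ⊗ₘ T.oneIso.hom) := by
    rw [reassoc_of% T.oneIso_comap f, Iso.hom_inv_id, Category.comp_id]
  -- Passing from the splitting `2 + 1` of three points to `1 + 2` produces the associator in the
  -- Frobenius law.
  have ha : (T.tensorIso 2 1).hom =
      (T.tensorIso 1 1).inv ▷ T.obj 1 ≫ (α_ _ _ _).hom ≫ T.obj 1 ◁ (T.tensorIso 1 1).hom ≫
        (T.tensorIso 1 2).hom := by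
    have h := T.tensorIso_assoc 1 1 1
    rw [show ⇑(finCongr (Nat.add_assoc 1 1 1)) = id from rfl, map_id, Category.comp_id] at h
    rw [← h, inv_hom_whiskerRight_assoc]
  have h₁ := T.comap_natural f (id : Fin 1 → Fin 1)
  have h₂ := T.tensorIso_natural (id : Fin 1 → Fin 1) f
  rw [comap_id, tensorHom_id] at h₁
  rw [map_id, id_tensorHom] at h₂
  rw [← cancel_epi (T.tensorIso 1 1).hom, ← reassoc_of% h₁, ha]
  simp only [Category.assoc]
  rw [← h₂, ← cancel_epi (T.oneIso.hom ⊗ₘ T.oneIso.hom), reassoc_of% hm,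
    ← cancel_mono (T.tensorIso 1 1).inv]
  simp only [Category.assoc, Iso.hom_inv_id, Category.comp_id]
  rw [hc, ← whiskerLeft_comp, ← comp_whiskerRight_assoc, ← tensorHom_id,
    tensorHom_comp_tensorHom_assoc, hc, Category.comp_id,
    ← reassoc_of% IsSpecialFrobenius.frobenius (X := X), ← id_tensorHom]
  have h₃ : μ[op X].unop ≫ (T.oneIso.hom ⊗ₘ T.oneIso.hom) ⊗ₘ T.oneIso.hom =
      μ[op X].unop ▷ X ≫ ((T.oneIso.hom ⊗ₘ T.oneIso.hom) ⊗ₘ T.oneIso.hom) := by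
    rw [← tensorHom_id, tensorHom_comp_tensorHom, Category.id_comp]
  rw [h₃, Category.assoc, associator_naturality_assoc, tensorHom_comp_tensorHom, hm,
    Category.comp_id, ← id_tensorHom, tensorHom_comp_tensorHom, Category.id_comp]

end Comul

end TensorPowers

/-! ### Pasting and summing pushout squares of sets. -/

namespace FinCospan

section PushoutSquares

variable {S A B P : Type} {g : S → A} {h : S → B} {i : A → P} {j : B → P}

theorem IsPO.paste_left (hP : IsPO g h i j) {A' P' : Type} {g' : A → A'} {i' : A' → P'}
    {j' : P → P'} (hP' : IsPO g' i i' j') : IsPO (g' ∘ g) h i' (j' ∘ j) where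
  comm s := by simp only [Function.comp_apply]; rw [hP'.comm, hP.comm]
  desc T a b hab := by
    obtain ⟨w, w1, w2⟩ := hP.desc T (a ∘ g') b hab
    obtain ⟨z, z1, z2⟩ := hP'.desc T a w (fun s => (w1 s).symm)
    exact ⟨z, z1, fun x => by simp [z2, w2]⟩
  surj x := by
    rcases hP'.surj x with ⟨a, rfl⟩ | ⟨p, rfl⟩
    · exact Or.inl ⟨a, rfl⟩
    · rcases hP.surj p with ⟨a, rfl⟩ | ⟨b, rfl⟩
      · exact Or.inl ⟨g' a, hP'.comm a⟩
      · exact Or.inr ⟨b, rfl⟩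

theorem IsPO.symm (hP : IsPO g h i j) : IsPO h g j i where
  comm s := (hP.comm s).symm
  desc T a b hab := by
    obtain ⟨w, w1, w2⟩ := hP.desc T b a (fun s => (hab s).symm)
    exact ⟨w, w2, w1⟩
  surj x := (hP.surj x).symm

theorem IsPO.paste_right (hP : IsPO g h i j) {B' P' : Type} {h' : B → B'} {i' : P → P'}
    {j' : B' → P'} (hP' : IsPO j h' i' j') : IsPO g (h' ∘ h) (i' ∘ i) j' :=
  (hP.symm.paste_left hP'.symm).symm

theorem IsPO.sum (hP : IsPO g h i j) {S' A' B' P' : Type} {g' : S' → A'} {h' : S' → B'}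
    {i' : A' → P'} {j' : B' → P'} (hP' : IsPO g' h' i' j') :
    IsPO (Sum.map g g') (Sum.map h h') (Sum.map i i') (Sum.map j j') where
  comm := by
    rintro (s | s)
    · exact congrArg Sum.inl (hP.comm s)
    · exact congrArg Sum.inr (hP'.comm s)
  desc T a b hab := by
    obtain ⟨w, w1, w2⟩ := hP.desc T (a ∘ Sum.inl) (b ∘ Sum.inl) (fun s => hab (Sum.inl s))
    obtain ⟨z, z1, z2⟩ := hP'.desc T (a ∘ Sum.inr) (b ∘ Sum.inr) (fun s => hab (Sum.inr s))
    refine ⟨Sum.elim w z, ?_, ?_⟩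
    · rintro (x | x)
      · exact w1 x
      · exact z1 x
    · rintro (x | x)
      · exact w2 x
      · exact z2 x
  surj := by
    rintro (x | x)
    · rcases hP.surj x with ⟨a, rfl⟩ | ⟨b, rfl⟩
      · exact Or.inl ⟨Sum.inl a, rfl⟩
      · exact Or.inr ⟨Sum.inl b, rfl⟩
    · rcases hP'.surj x with ⟨a, rfl⟩ | ⟨b, rfl⟩
      · exact Or.inl ⟨Sum.inr a, rfl⟩
      · exact Or.inr ⟨Sum.inr b, rfl⟩

theorem isPO_of_equiv (e : S ≃ A) (h : S → B) : IsPO e h (h ∘ e.symm) id where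
  comm s := by simp
  desc _ a b hab := ⟨b, fun x => by simp [← hab], fun _ => rfl⟩
  surj x := Or.inr ⟨x, rfl⟩

/-- Whatever `g` identifies, `k ∘ g` has already identified, so `B` undergoes no further gluing. -/
theorem isPO_of_surjective (hg : Function.Surjective g) (k : A → B) : IsPO g (k ∘ g) k id where
  comm _ := rfl
  desc _ a b hab := ⟨b, fun x => by obtain ⟨s, rfl⟩ := hg x; exact (hab s).symm, fun _ => rfl⟩
  surj x := Or.inr ⟨x, rfl⟩

theorem IsPO.precomp_equiv (hP : IsPO g h i j) {S' : Type} (e : S' ≃ S) :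
    IsPO (g ∘ e) (h ∘ e) i j where
  comm s := hP.comm (e s)
  desc T a b hab := hP.desc T a b (fun s => by simpa using hab (e.symm s))
  surj := hP.surj

end PushoutSquares

end FinCospan

/-! ### Actions of functions of finite types, and stability of the Beck-Chevalley condition. -/

namespace TensorPowers

open MonObj Opposite FinCospan

/-- The enumeration of a sum of two finite types by a sum of enumerations. -/
noncomputable def sumEnum (A B : Type) [Finite A] [Finite B] :
    Fin (Nat.card A + Nat.card B) ≃ Fin (Nat.card (A ⊕ B)) :=
  finSumFinEquiv.symm.trans (((Finite.equivFin A).symm.sumCongr (Finite.equivFin B).symm).trans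
    (Finite.equivFin (A ⊕ B)))

variable {A B D A' B' : Type} [Finite A] [Finite B] [Finite D] [Finite A'] [Finite B']

theorem comp_sumEnum (f : A → B) (g : A' → B') :
    (Finite.equivFin (B ⊕ B') ∘ Sum.map f g ∘ (Finite.equivFin (A ⊕ A')).symm) ∘ sumEnum A A' =
      sumEnum B B' ∘ finSumFinEquiv ∘ sumMap (Finite.equivFin B ∘ f ∘ (Finite.equivFin A).symm)
        (Finite.equivFin B' ∘ g ∘ (Finite.equivFin A').symm) := by
  funext x
  induction x using Fin.addCases <;> simp [sumEnum]

variable {C : Type u} [Category.{v} C] [MonoidalCategory C] [SymmetricCategory C] {X : C}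

section Map

variable [MonObj X] [IsCommMonObj X] (T : TensorPowers X)

/-- The isomorphism of tensor powers given by a bijection. -/
@[simps]
def mapIso {m n : ℕ} (e : Fin m ≃ Fin n) : T.obj m ≅ T.obj n where
  hom := T.map e
  inv := T.map e.symm
  hom_inv_id := by rw [← map_comp, Equiv.symm_comp_self, map_id]
  inv_hom_id := by rw [← map_comp, Equiv.self_comp_symm, map_id]

/-- The morphism of tensor powers given by a function of finite types, in terms of arbitrary
enumerations of these types. -/
noncomputable def mapType (f : A → B) : T.obj (Nat.card A) ⟶ T.obj (Nat.card B) :=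
  T.map (Finite.equivFin B ∘ f ∘ (Finite.equivFin A).symm)

theorem mapType_id : T.mapType (id : A → A) = 𝟙 _ := by simp [mapType]

theorem mapType_comp (f : A → B) (g : B → D) :
    T.mapType (g ∘ f) = T.mapType f ≫ T.mapType g := by
  rw [mapType, mapType, mapType, ← map_comp]
  congr 1
  funext x
  simp

/-- The tensor product of the tensor powers of two finite types. -/
noncomputable def sumIso (A B : Type) [Finite A] [Finite B] :
    T.obj (Nat.card A) ⊗ T.obj (Nat.card B) ≅ T.obj (Nat.card (A ⊕ B)) :=
  T.tensorIso _ _ ≪≫ T.mapIso (sumEnum A B)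

theorem mapType_sum (f : A → B) (g : A' → B') :
    (T.mapType f ⊗ₘ T.mapType g) ≫ (T.sumIso B B').hom =
      (T.sumIso A A').hom ≫ T.mapType (Sum.map f g) := by
  rw [mapType, mapType, sumIso, sumIso, Iso.trans_hom, Iso.trans_hom,
    reassoc_of% T.tensorIso_natural, mapIso_hom, mapIso_hom, mapType, Category.assoc, ← map_comp,
    ← map_comp, comp_sumEnum]

end Map

section Comap

variable [MonObj (op X)] [IsCommMonObj (op X)] (T : TensorPowers X)

/-- The contravariant analogue of `mapType`. -/
noncomputable def comapType (f : A → B) : T.obj (Nat.card B) ⟶ T.obj (Nat.card A) :=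
  T.comap (Finite.equivFin B ∘ f ∘ (Finite.equivFin A).symm)

theorem comapType_id : T.comapType (id : A → A) = 𝟙 _ := by simp [comapType]

theorem comapType_comp (f : A → B) (g : B → D) :
    T.comapType (g ∘ f) = T.comapType g ≫ T.comapType f := by
  rw [comapType, comapType, comapType, ← comap_comp]
  congr 1
  funext x
  simp

end Comap

variable [MonObj X] [IsCommMonObj X] [MonObj (op X)] [IsCommMonObj (op X)] (T : TensorPowers X)

theorem comapType_equiv (e : A ≃ B) : T.comapType e = T.mapType e.symm :=
  T.comap_equiv ((Finite.equivFin A).symm.trans (e.trans (Finite.equivFin B)))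

theorem comapType_sum (f : A → B) (g : A' → B') :
    (T.comapType f ⊗ₘ T.comapType g) ≫ (T.sumIso A A').hom =
      (T.sumIso B B').hom ≫ T.comapType (Sum.map f g) := by
  -- Applying `comap` reverses the composites, and `comap_equiv` turns the enumerations into
  -- inverses of the isomorphisms inside `sumIso`.
  have h := congrArg T.comap (comp_sumEnum f g)
  rw [comap_comp, comap_comp, comap_equiv, comap_equiv] at h
  rw [comapType, comapType, sumIso, sumIso, Iso.trans_hom, Iso.trans_hom,
    reassoc_of% T.comap_natural, comapType, Category.assoc]
  have h' : _ ≫ (T.mapIso (sumEnum A A')).inv = (T.mapIso (sumEnum B B')).inv ≫ _ := h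
  rw [Iso.comp_inv_eq, Category.assoc, Iso.eq_inv_comp] at h'
  rw [h']

/-- The Beck-Chevalley condition for a square of functions between finite types. -/
def BeckChevalley (T : TensorPowers X) {S A B : Type} [Finite S] [Finite A] [Finite B]
    (g : S → A) (h : S → B) : Prop :=
  ∀ ⦃P : Type⦄ [Finite P] ⦃i : A → P⦄ ⦃j : B → P⦄, IsPO g h i j →
    T.comapType g ≫ T.mapType h = T.mapType i ≫ T.comapType j

namespace BeckChevalley

variable {T} {S : Type} [Finite S] {g : S → A} {h : S → B}

/-- One pushout suffices: any other differs by a bijection `e` of the apex, and `map e` and `comap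
e` are mutually inverse. -/
theorem of_isPO {P : Type} [Finite P] {i : A → P} {j : B → P} (hP : IsPO g h i j)
    (H : T.comapType g ≫ T.mapType h = T.mapType i ≫ T.comapType j) : T.BeckChevalley g h := by
  intro Q _ i' j' hQ
  obtain ⟨e, h₁, h₂⟩ := hP.unique hQ
  obtain rfl : i' = e ∘ i := (funext h₁).symm
  obtain rfl : j' = e ∘ j := (funext h₂).symm
  rw [H, comapType_comp, comapType_equiv, ← reassoc_of% T.mapType_comp (e ∘ i) e.symm,
    ← Function.comp_assoc, Equiv.symm_comp_self, Function.id_comp]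

theorem of_equiv (e : S ≃ A) (h : S → B) : T.BeckChevalley e h :=
  of_isPO (isPO_of_equiv e h) (by
    rw [comapType_equiv, comapType_id, mapType_comp, Category.comp_id])

theorem of_equiv_right (g : S → A) (e : S ≃ B) : T.BeckChevalley g e :=
  of_isPO (isPO_of_equiv e g).symm (by
    rw [mapType_id, Category.id_comp, comapType_comp, comapType_equiv, Equiv.symm_symm])

theorem paste_left {P : Type} [Finite P] {i : A → P} {j : B → P} (hP : IsPO g h i j)
    (H : T.BeckChevalley g h) {g' : A → A'} (H' : T.BeckChevalley g' i) :
    T.BeckChevalley (g' ∘ g) h := by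
  refine of_isPO (hP.paste_left (isPO_pushout g' i)) ?_
  rw [comapType_comp, Category.assoc, H hP, reassoc_of% H' (isPO_pushout g' i), comapType_comp]

theorem paste_right {P : Type} [Finite P] {i : A → P} {j : B → P} (hP : IsPO g h i j)
    (H : T.BeckChevalley g h) {h' : B → B'} (H' : T.BeckChevalley j h') :
    T.BeckChevalley g (h' ∘ h) := by
  refine of_isPO (hP.paste_right (isPO_pushout j h')) ?_
  rw [mapType_comp, reassoc_of% H hP, H' (isPO_pushout j h'), mapType_comp, Category.assoc]

theorem precomp_equiv (H : T.BeckChevalley g h) {S' : Type} [Finite S'] (e : S' ≃ S) :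
    T.BeckChevalley (g ∘ e) (h ∘ e) := by
  refine of_isPO ((isPO_pushout g h).precomp_equiv e) ?_
  rw [comapType_comp, mapType_comp, comapType_equiv, Category.assoc, ← reassoc_of% T.mapType_comp,
    Equiv.self_comp_symm, mapType_id, Category.id_comp, H (isPO_pushout g h)]

theorem congr (H : T.BeckChevalley g h) {S' : Type} [Finite S'] {g' : S' → A'} {h' : S' → B'}
    (eS : S ≃ S') (eA : A ≃ A') (eB : B ≃ B') (hg : ∀ s, g' (eS s) = eA (g s))
    (hh : ∀ s, h' (eS s) = eB (h s)) : T.BeckChevalley g' h' := by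
  have hg' : g' = eA ∘ g ∘ eS.symm := by
    funext s; simpa using hg (eS.symm s)
  have hh' : h' = eB ∘ h ∘ eS.symm := by
    funext s; simpa using hh (eS.symm s)
  have H' := H.precomp_equiv eS.symm
  have H'' := paste_left (isPO_pushout _ _) H' (of_equiv eA _)
  rw [hg', hh']
  exact paste_right (isPO_pushout _ _) H'' (of_equiv_right _ eB)

theorem sum {S' : Type} [Finite S'] {g' : S' → A'} {h' : S' → B'} (H : T.BeckChevalley g h)
    (H' : T.BeckChevalley g' h') : T.BeckChevalley (Sum.map g g') (Sum.map h h') := by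
  have hP := isPO_pushout g h
  have hP' := isPO_pushout g' h'
  refine of_isPO (hP.sum hP') ?_
  rw [← cancel_epi (T.sumIso A A').hom, ← reassoc_of% T.comapType_sum, ← mapType_sum,
    ← reassoc_of% T.mapType_sum, ← comapType_sum, tensorHom_comp_tensorHom_assoc, H hP, H' hP',
    tensorHom_comp_tensorHom_assoc]

/-- Up to relabelling, `Sum.inl` and `h` are sums: the identity of `S` against `h`, plus the
function from `Empty` to `S'` against an identity. Each summand has a bijective side. -/
theorem inl (S' : Type) [Finite S'] (h : S → B) :
    T.BeckChevalley (Sum.inl : S → S ⊕ S') h := by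
  have H : T.BeckChevalley (Sum.map (Equiv.refl S) (Empty.elim : Empty → S'))
      (Sum.map h (Equiv.refl Empty)) :=
    (of_equiv (Equiv.refl S) h).sum (of_equiv_right _ (Equiv.refl Empty))
  refine H.congr (Equiv.sumEmpty S Empty) (Equiv.refl _) (Equiv.sumEmpty B Empty) ?_ ?_ <;>
  · rintro (s | s)
    · rfl
    · exact s.elim

end BeckChevalley

end TensorPowers

/-! ### The Beck-Chevalley condition for special commutative Frobenius monoids. -/

namespace TensorPowers

open MonObj Opposite FinCospan

open Classical in
/-- An injective function as a coprojection of its codomain. -/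
noncomputable def complSumEquiv {K B : Type} (u : K → B) (hu : Function.Injective u) :
    ((Set.range u)ᶜ : Set B) ⊕ K ≃ B :=
  (Equiv.sumComm _ _).trans (((Equiv.ofInjective u hu).sumCongr (Equiv.refl _)).trans
    (Equiv.Set.sumCompl (Set.range u)))

@[simp]
theorem complSumEquiv_inl {K B : Type} (u : K → B) (hu : Function.Injective u)
    (b : ((Set.range u)ᶜ : Set B)) : complSumEquiv u hu (Sum.inl b) = b := by
  simp [complSumEquiv]

@[simp]
theorem complSumEquiv_inr {K B : Type} (u : K → B) (hu : Function.Injective u) (k : K) :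
    complSumEquiv u hu (Sum.inr k) = u k := by
  simp [complSumEquiv]

variable {C : Type u} [Category.{v} C] [MonoidalCategory C] [SymmetricCategory C] {X : C}
  [MonObj X] [IsCommMonObj X]

/-- The function from a two-element set to a one-element set. -/
def fold : Fin 2 → Fin 1 := fun _ => 0

theorem mapType_fin (T : TensorPowers X) {m n : ℕ} (f : Fin m → Fin n) :
    T.mapType f = (T.mapIso (Finite.equivFin (Fin m))).inv ≫ T.map f ≫
      (T.mapIso (Finite.equivFin (Fin n))).hom := by
  rw [mapType, map_comp, map_comp]
  simp

variable [MonObj (op X)] [IsCommMonObj (op X)] (T : TensorPowers X)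

theorem comapType_fin {m n : ℕ} (f : Fin m → Fin n) :
    T.comapType f = (T.mapIso (Finite.equivFin (Fin n))).inv ≫ T.comap f ≫
      (T.mapIso (Finite.equivFin (Fin m))).hom := by
  rw [comapType, comap_comp, comap_comp, comap_equiv, comap_equiv, Equiv.symm_symm]
  simp

theorem beckChevalley_fin_iff {s a b p : ℕ} {g : Fin s → Fin a} {h : Fin s → Fin b}
    {i : Fin a → Fin p} {j : Fin b → Fin p} :
    T.comapType g ≫ T.mapType h = T.mapType i ≫ T.comapType j ↔
      T.comap g ≫ T.map h = T.map i ≫ T.comap j := by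
  simp only [comapType_fin, mapType_fin, Category.assoc, Iso.hom_inv_id_assoc,
    Iso.cancel_iso_inv_left]
  simp only [← Category.assoc, Iso.cancel_iso_hom_right]

variable {A B B' : Type} [Finite A] [Finite B] [Finite B']

/-- The Beck-Chevalley condition holds for all squares with a given side. -/
def Good {S A : Type} [Finite S] [Finite A] (g : S → A) : Prop :=
  ∀ ⦃B : Type⦄ [Finite B] (h : S → B), T.BeckChevalley g h

-- By pasting, it is enough to treat the factors of `g` one at a time, against arbitrary `h`.
variable {T} in
theorem Good.comp {g : A → B} {g' : B → B'} (hg : T.Good g) (hg' : T.Good g') :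
    T.Good (g' ∘ g) := fun _ _ h =>
  BeckChevalley.paste_left (isPO_pushout g h) (hg h) (hg' _)

theorem good_equiv (e : A ≃ B) : T.Good e := fun _ _ h => BeckChevalley.of_equiv e h

variable [IsSpecialFrobenius X]

theorem comapType_comp_mapType_fold : T.comapType fold ≫ T.mapType fold = 𝟙 _ := by
  have h := (T.beckChevalley_fin_iff (g := fold) (h := fold) (i := id) (j := id)).2 (by
    rw [T.comap_comp_map_fold]; simp)
  rwa [mapType_id, comapType_id, Category.comp_id] at h

/-- Three points in a chain, one side gluing the first two and the other the last two, have a single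
point as pushout. The condition for this square is exactly the Frobenius law. -/
theorem beckChevalley_frobenius :
    T.BeckChevalley (![0, 0, 1] : Fin 3 → Fin 2) (![0, 1, 1] : Fin 3 → Fin 2) := by
  have hP : IsPO (![0, 0, 1] : Fin 3 → Fin 2) (![0, 1, 1] : Fin 3 → Fin 2) fold fold :=
    { comm := by decide
      desc := fun _ a b hab => ⟨fun _ => a 0, fun x => by
        have h₀ := hab 0
        have h₁ := hab 1
        have h₂ := hab 2
        fin_cases x <;> simp_all, fun x => by
        have h₀ := hab 0
        have h₁ := hab 1
        have h₂ := hab 2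
        fin_cases x <;> simp_all⟩
      surj := by decide }
  refine .of_isPO hP ((T.beckChevalley_fin_iff).2 ?_)
  convert T.frobenius fold using 3
  · decide
  · decide

/-- The codiagonal `![0, 1, 0, 1]` glues `0` with `2` and then `1` with `3`. Each gluing meets the
pair `2`, `3` in one point only, so each gives a Frobenius square up to relabelling (the first with
a spare point), and the two squares paste. -/
theorem beckChevalley_frobenius_two :
    T.BeckChevalley (![0, 1, 2, 2] : Fin 4 → Fin 3) (![0, 1, 0, 1] : Fin 4 → Fin 2) := by
  have h₁ : T.BeckChevalley (![0, 1, 2, 2] : Fin 4 → Fin 3) (![1, 0, 1, 2] : Fin 4 → Fin 3) :=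
    ((BeckChevalley.of_equiv (Equiv.refl (Fin 1)) (Equiv.refl (Fin 1))).sum
        T.beckChevalley_frobenius).congr
      (Equiv.ofBijective (Sum.elim ![1] ![3, 2, 0]) (by decide))
      (Equiv.ofBijective (Sum.elim ![1] ![2, 0]) (by decide))
      (Equiv.ofBijective (Sum.elim ![0] ![2, 1]) (by decide)) (by decide) (by decide)
  have h₂ : T.BeckChevalley (![0, 1, 1] : Fin 3 → Fin 2) (![1, 0, 1] : Fin 3 → Fin 2) :=
    T.beckChevalley_frobenius.congr
      (Equiv.ofBijective ![1, 2, 0] (by decide))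
      (Equiv.ofBijective ![1, 0] (by decide))
      (Equiv.ofBijective ![0, 1] (by decide)) (by decide) (by decide)
  -- After the first gluing, the merge of `2` and `3` has become `![0, 1, 1]`, which is the side of
  -- the second square.
  have hP : IsPO (![0, 1, 2, 2] : Fin 4 → Fin 3) (![1, 0, 1, 2] : Fin 4 → Fin 3)
      (![1, 0, 1] : Fin 3 → Fin 2) (![0, 1, 1] : Fin 3 → Fin 2) :=
    { comm := by decide
      desc := fun _ a b hab => ⟨b ∘ ![0, 1], fun x => by
        have h₀ := hab 0
        have h₁ := hab 1
        have h₂ := hab 2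
        have h₃ := hab 3
        fin_cases x <;> simp_all, fun x => by
        have h₀ := hab 0
        have h₁ := hab 1
        have h₂ := hab 2
        have h₃ := hab 3
        fin_cases x <;> simp_all⟩
      surj := by decide }
  have h := BeckChevalley.paste_right hP h₁ h₂
  rwa [show (![1, 0, 1] : Fin 3 → Fin 2) ∘ (![1, 0, 1, 2] : Fin 4 → Fin 3) = ![0, 1, 0, 1] by
    decide] at h

/-- The function that merges the two points of `Fin 2`. -/
def merge (A : Type) : A ⊕ Fin 2 → A ⊕ Fin 1 := Sum.map id fold

theorem beckChevalley_merge_codiag (B : Type) [Finite B] :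
    T.BeckChevalley (merge (B ⊕ Fin 2))
      (Sum.elim id Sum.inr : (B ⊕ Fin 2) ⊕ Fin 2 → B ⊕ Fin 2) := by
  refine ((BeckChevalley.of_equiv (Equiv.refl B) (Equiv.refl B)).sum
    T.beckChevalley_frobenius_two).congr
    (((Equiv.refl B).sumCongr (finSumFinEquiv (m := 2) (n := 2)).symm).trans
      (Equiv.sumAssoc _ _ _).symm)
    (((Equiv.refl B).sumCongr (finSumFinEquiv (m := 2) (n := 1)).symm).trans
      (Equiv.sumAssoc _ _ _).symm) (Equiv.refl _) ?_ ?_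
  · rintro (s | s)
    · rfl
    · fin_cases s <;> rfl
  · rintro (s | s)
    · rfl
    · fin_cases s <;> rfl

/-- Here `h` is a sum of its restriction to `A` and the identity of `Fin 2`, followed by a
codiagonal. The sum does not interact with the merged points, and the codiagonal was treated above.
-/
theorem beckChevalley_merge_of_fix (h : A ⊕ Fin 2 → B ⊕ Fin 2)
    (hh : ∀ x, h (Sum.inr x) = Sum.inr x) : T.BeckChevalley (merge A) h := by
  have hP : IsPO (merge A) (Sum.map (h ∘ Sum.inl) id) (Sum.map (h ∘ Sum.inl) id)
      (merge (B ⊕ Fin 2)) :=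
    (isPO_of_equiv (Equiv.refl A) (h ∘ Sum.inl)).sum (isPO_of_equiv (Equiv.refl (Fin 2)) fold).symm
  have h₁ : T.BeckChevalley (merge A) (Sum.map (h ∘ Sum.inl) id) :=
    (BeckChevalley.of_equiv (Equiv.refl A) (h ∘ Sum.inl)).sum
      (BeckChevalley.of_equiv_right fold (Equiv.refl (Fin 2)))
  have := BeckChevalley.paste_right hP h₁ (T.beckChevalley_merge_codiag B)
  convert this using 1
  funext x
  rcases x with x | x
  · rfl
  · exact hh x

/-- If `h` identifies the two points, it factors through `merge A` and the special law applies.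
Otherwise their images are two distinct points of `B`; splitting these off as a summand makes `h`
fix them. -/
theorem beckChevalley_merge (h : A ⊕ Fin 2 → B) : T.BeckChevalley (merge A) h := by
  by_cases h01 : h (Sum.inr 0) = h (Sum.inr 1)
  · have hs : Function.Surjective (merge A) := by
      rintro (a | x)
      · exact ⟨Sum.inl a, rfl⟩
      · exact ⟨Sum.inr 0, by rw [Subsingleton.elim x 0]; rfl⟩
    have hk : h = Sum.elim (h ∘ Sum.inl) (fun _ => h (Sum.inr 0)) ∘ merge A := by
      funext x
      rcases x with x | x
      · rfl
      · fin_cases x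
        · rfl
        · exact h01.symm
    rw [hk]
    refine .of_isPO (isPO_of_surjective hs _) ?_
    have hm : T.comapType (merge A) ≫ T.mapType (merge A) = 𝟙 _ := by
      rw [← cancel_epi (T.sumIso A (Fin 1)).hom, merge, ← reassoc_of% T.comapType_sum,
        ← mapType_sum, tensorHom_comp_tensorHom_assoc, T.comapType_comp_mapType_fold,
        comapType_id, mapType_id, Category.comp_id, id_tensorHom_id, Category.id_comp,
        Category.comp_id]
    rw [mapType_comp, reassoc_of% hm, comapType_id, Category.comp_id]
  · have hu : Function.Injective (h ∘ Sum.inr) := by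
      intro x y hxy
      fin_cases x <;> fin_cases y <;> simp_all
    let e := complSumEquiv (h ∘ Sum.inr) hu
    refine (T.beckChevalley_merge_of_fix (e.symm ∘ h) ?_).congr (Equiv.refl _) (Equiv.refl _) e
      (fun _ => rfl) (fun x => (e.apply_symm_apply _).symm)
    intro x
    simp [e, Equiv.symm_apply_eq]

theorem good_getD (a : A) : T.Good (fun o : Option A => o.getD a) := by
  let u : Fin 1 → A := fun _ => a
  have hu : Function.Injective u := Function.injective_of_subsingleton _
  let e := complSumEquiv u hu
  -- The only fibre with two elements is the one over `a`; here `0` stands for `some a` and `1` for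
  -- `none`.
  let e' : ((Set.range u)ᶜ : Set A) ⊕ Fin 2 ≃ Option A :=
    ((Equiv.refl _).sumCongr (finSumFinEquiv (m := 1) (n := 1)).symm).trans
      ((Equiv.sumAssoc _ _ _).symm.trans ((e.sumCongr (Equiv.equivPUnit (Fin 1))).trans
        (Equiv.optionEquivSumPUnit.{0} A).symm))
  have h : (fun o : Option A => o.getD a) = e ∘ merge _ ∘ e'.symm := by
    funext o
    obtain ⟨x, rfl⟩ := e'.surjective o
    rw [Function.comp_apply, Function.comp_apply, Equiv.symm_apply_apply]
    rcases x with x | x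
    · simp [e', e, merge]
    · fin_cases x
      · change (some (e (Sum.inr 0))).getD a = _
        simp [e, merge, u]
      · simp only [Fin.mk_one, merge]
        exact (complSumEquiv_inr u hu 0).symm
  rw [h]
  exact ((T.good_equiv e'.symm).comp fun _ _ h => T.beckChevalley_merge h).comp (T.good_equiv e)

/-- The points of `S` are absorbed one by one, each step being an instance of `good_getD`. -/
theorem good_elim (S : Type) [Finite S] (A : Type) [Finite A] (t : S → A) :
    T.Good (Sum.elim t id : S ⊕ A → A) := by
  suffices h : ∀ [Finite S] (A : Type) [Finite A] (t : S → A),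
      T.Good (Sum.elim t id : S ⊕ A → A) from h A t
  refine Finite.induction_empty_option (P := fun S => ∀ [Finite S] (A : Type) [Finite A]
    (t : S → A), T.Good (Sum.elim t id : S ⊕ A → A)) ?_ ?_ ?_ S
  · intro S S' e ih _ A _ t
    have := Finite.of_equiv _ e.symm
    have h := (T.good_equiv (e.symm.sumCongr (Equiv.refl A))).comp (ih A (t ∘ e))
    convert h using 1
    funext x
    rcases x with x | x <;> simp
  · intro _ A _ t
    convert T.good_equiv (Equiv.emptySum PEmpty A) using 1
    funext x
    rcases x with x | x
    · exact x.elim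
    · rfl
  · intro S _ ih _ A _ t
    let e : Option S ⊕ A ≃ Option (S ⊕ A) :=
      { toFun := Sum.elim (Option.elim · none (some ∘ Sum.inl)) (some ∘ Sum.inr)
        invFun := fun o => o.elim (Sum.inl none) (Sum.map some id)
        left_inv := by rintro ((_ | _) | _) <;> rfl
        right_inv := by rintro (_ | (_ | _)) <;> rfl }
    convert ((T.good_equiv e).comp (T.good_getD (Sum.inr (t none)))).comp (ih A (t ∘ some)) using 1
    funext x
    rcases x with (_ | x) | x <;> rfl

/-- The Beck-Chevalley condition for the tensor powers of a special commutative Frobenius monoid. -/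
theorem beckChevalley (g : A → B) (h : A → B') : T.BeckChevalley g h :=
  -- Every `g : A → B` is the coprojection `A → A ⊕ B` followed by `Sum.elim g id`.
  Good.comp (g := Sum.inl) (g' := Sum.elim g id) (fun _ _ h => BeckChevalley.inl B h)
    (T.good_elim A B g) h

theorem comap_comp_map {s a b p : ℕ} {g : Fin s → Fin a} {h : Fin s → Fin b}
    {i : Fin a → Fin p} {j : Fin b → Fin p} (hP : IsPO g h i j) :
    T.comap g ≫ T.map h = T.map i ≫ T.comap j :=
  T.beckChevalley_fin_iff.1 (T.beckChevalley g h hP)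

end TensorPowers

/-! ### The symmetric monoidal functor of a special commutative Frobenius monoid. -/

theorem FinCospan.IsPO.postcomp_equiv {S A B P Q : Type} {g : S → A} {h : S → B} {i : A → P}
    {j : B → P} (hP : IsPO g h i j) (e : P ≃ Q) : IsPO g h (e ∘ i) (e ∘ j) where
  comm s := congrArg e (hP.comm s)
  desc T a b hab := by
    obtain ⟨w, w1, w2⟩ := hP.desc T a b hab
    exact ⟨w ∘ e.symm, fun x => by simp [w1], fun x => by simp [w2]⟩
  surj x := by
    rcases hP.surj (e.symm x) with ⟨a, ha⟩ | ⟨b, hb⟩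
    · exact Or.inl ⟨a, by simp [ha]⟩
    · exact Or.inr ⟨b, by simp [hb]⟩

/-- Compatibility of a morphism with the operations of two Frobenius monoids. -/
structure FrobeniusData.IsHom {C : Type u} [Category.{v} C] [MonoidalCategory C]
    (S T : FrobeniusData C) (f : S.X ⟶ T.X) : Prop where
  mul : (f ⊗ₘ f) ≫ T.mul = S.mul ≫ f
  unit : S.unit ≫ f = T.unit
  comul : f ≫ T.comul = S.comul ≫ (f ⊗ₘ f)
  counit : f ≫ T.counit = S.counit

theorem FrobeniusData.IsHom.eq_of_eqToHom {C : Type u} [Category.{v} C] [MonoidalCategory C]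
    {S T : FrobeniusData C} {f : S.X ⟶ T.X} (hf : S.IsHom T f) (h : S.X = T.X)
    (hfh : f = eqToHom h) : S = T := by
  obtain ⟨X, _, _, _, _⟩ := S
  obtain ⟨Y, _, _, _, _⟩ := T
  obtain rfl : X = Y := h
  subst hfh
  obtain ⟨h₁, h₂, h₃, h₄⟩ := hf
  simp_all

theorem FrobeniusData.isHom_eqToHom {C : Type u} [Category.{v} C] [MonoidalCategory C]
    {S T : FrobeniusData C} (h : S = T) :
    S.IsHom T (eqToHom (congrArg FrobeniusData.X h)) := by
  subst h
  constructor <;> simp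

namespace TensorPowers

open MonObj Opposite FinCospan

variable {C : Type u} [Category.{v} C] [MonoidalCategory C]

section Cospan

variable [SymmetricCategory C] {X : C}
  [MonObj X] [IsCommMonObj X] [MonObj (op X)] [IsCommMonObj (op X)] (T : TensorPowers X)

/-- The morphism of tensor powers given by an isomorphism class of cospans. -/
def cospanMap {m n : ℕ} : CHom m n → (T.obj m ⟶ T.obj n) :=
  Quotient.lift (fun c => T.map c.left ≫ T.comap c.right) (by
    rintro c d ⟨e, h₁, h₂⟩
    have : T.map e ≫ T.comap e = 𝟙 _ := by
      rw [comap_equiv, ← map_comp, Equiv.symm_comp_self, map_id]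
    change T.map c.left ≫ T.comap c.right = T.map d.left ≫ T.comap d.right
    rw [← h₁, ← h₂, map_comp, comap_comp, Category.assoc, reassoc_of% this])

theorem cospanMap_cls {m n p : ℕ} (f : Fin m → Fin p) (g : Fin n → Fin p) :
    T.cospanMap (cls (Fin p) f g) = T.map f ≫ T.comap g := by
  rw [cls_fin ⟨p, f, g⟩]
  rfl

theorem cospanMap_cls_of_equiv {m n p : ℕ} {A : Type} [Finite A] (f : Fin m → A) (g : Fin n → A)
    (e : A ≃ Fin p) : T.cospanMap (cls A f g) = T.map (e ∘ f) ≫ T.comap (e ∘ g) := by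
  rw [← cospanMap_cls]
  congr 1
  exact cls_eq_cls e (fun _ => rfl) (fun _ => rfl)

theorem cospanMap_ofFun {m n : ℕ} (f : Fin m → Fin n) : T.cospanMap (ofFun f) = T.map f := by
  rw [ofFun, cospanMap_cls, comap_id, Category.comp_id]

theorem cospanMap_spider_one (m : ℕ) : T.cospanMap (spider m 1) = T.map (fun _ => (0 : Fin 1)) := by
  rw [spider, cospanMap_cls, show (fun _ => 0 : Fin 1 → Fin 1) = id from by decide, comap_id,
    Category.comp_id]

theorem cospanMap_one_spider (n : ℕ) :
    T.cospanMap (spider 1 n) = T.comap (fun _ => (0 : Fin 1)) := by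
  rw [spider, cospanMap_cls, show (fun _ => 0 : Fin 1 → Fin 1) = id from by decide, map_id,
    Category.id_comp]

/-- The inner factors `comap g ≫ map h` of the composite are exchanged by the Beck-Chevalley
identity for the pushout that defines the composite cospan. -/
theorem cospanMap_comp [IsSpecialFrobenius X] {m n k : ℕ} (c : CHom m n) (d : CHom n k) :
    T.cospanMap (FinCospan.comp c d) = T.cospanMap c ≫ T.cospanMap d := by
  obtain ⟨p, f, g, rfl⟩ := c.ind
  obtain ⟨q, h, l, rfl⟩ := d.ind
  have hP := (isPO_pushout g h).postcomp_equiv (Finite.equivFin _)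
  rw [comp_cls hP, cospanMap_cls, cospanMap_cls, cospanMap_cls, map_comp, comap_comp]
  simp only [Category.assoc]
  rw [← reassoc_of% T.comap_comp_map hP]

theorem cospanMap_tensor {m n m' n' : ℕ} (c : CHom m n) (d : CHom m' n') :
    (T.cospanMap c ⊗ₘ T.cospanMap d) ≫ (T.tensorIso n n').hom =
      (T.tensorIso m m').hom ≫ T.cospanMap (FinCospan.tensor c d) := by
  obtain ⟨p, f, g, rfl⟩ := c.ind
  obtain ⟨q, h, l, rfl⟩ := d.ind
  rw [tensor_cls, T.cospanMap_cls_of_equiv _ _ finSumFinEquiv, cospanMap_cls, cospanMap_cls,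
    ← tensorHom_comp_tensorHom, Category.assoc, comap_natural, reassoc_of% T.tensorIso_natural]

variable [IsSpecialFrobenius X]

/-- The functor out of the category of cospans given by the tensor powers of a special commutative
Frobenius monoid. -/
def cospanFunctor : FinCospan ⥤ C where
  obj n := T.obj n.card
  map c := T.cospanMap c
  map_id _ := (T.cospanMap_ofFun id).trans (T.map_id _)
  map_comp c d := T.cospanMap_comp c d

/-- The coherence isomorphisms of `cospanFunctor`. -/
def cospanFunctorCoreMonoidal : T.cospanFunctor.CoreMonoidal where
  εIso := T.zero
  μIso m n := T.tensorIso m.card n.card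
  μIso_hom_natural_left f n := by
    have h := T.cospanMap_tensor f (ofFun (id : Fin n.card → Fin n.card))
    rwa [cospanMap_ofFun, map_id, tensorHom_id] at h
  μIso_hom_natural_right m f := by
    have h := T.cospanMap_tensor (ofFun (id : Fin m.card → Fin m.card)) f
    rwa [cospanMap_ofFun, map_id, id_tensorHom] at h
  associativity m n k := by
    refine Eq.trans ?_ (T.tensorIso_assoc m.card n.card k.card)
    rw [← cospanMap_ofFun]
    rfl
  left_unitality n := by
    refine (T.tensorIso_left_unitality n.card).trans ?_
    rw [← cospanMap_ofFun]
    rfl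
  right_unitality n := by
    refine (T.tensorIso_right_unitality n.card).trans ?_
    rw [← cospanMap_ofFun]
    rfl

/-- The symmetric monoidal functor out of the category of cospans given by the tensor powers of a
special commutative Frobenius monoid. -/
noncomputable def cospanSymmMonFunctor : SymmMonFunctor FinCospan C where
  toFunctor := T.cospanFunctor
  braided :=
    { T.cospanFunctorCoreMonoidal.toMonoidal with
      braided := fun m n => by
        refine Eq.trans ?_ (T.tensorIso_braided m.card n.card)
        rw [← cospanMap_ofFun]
        rfl }

theorem isHom_oneIso : FrobeniusData.IsHom
    ⟨X, MonObj.mul, MonObj.one, μ[op X].unop, η[op X].unop⟩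
    T.cospanSymmMonFunctor.frobeniusData T.oneIso.hom where
  mul := by
    refine Eq.trans ?_ (T.oneIso_map (fun _ => 0))
    rw [← cospanMap_spider_one]
    rfl
  unit := by
    refine (T.zero_map (fun _ => 0)).symm.trans ?_
    rw [← cospanMap_spider_one]
    rfl
  comul := by
    have h := T.oneIso_comap (fun _ => 0)
    rw [← cospanMap_one_spider, ← Category.assoc, ← Iso.comp_inv_eq, Category.assoc] at h
    exact h
  counit := by
    have h := T.comap_zero (fun _ => 0)
    rw [← cospanMap_one_spider, Iso.eq_inv_comp] at h
    exact h

end Cospan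

/-- The object part of `TensorPowers.standard`. -/
def standardObj (X : C) : ℕ → C
  | 0 => 𝟙_ C
  -- A case of its own, so that the first power is `X` itself and not `𝟙_ C ⊗ X`.
  | 1 => X
  | n + 2 => standardObj X (n + 1) ⊗ X

/-- The tensor powers `𝟙_ C`, `X`, `X ⊗ X`, `(X ⊗ X) ⊗ X`, … -/
def standard (X : C) : TensorPowers X where
  obj := standardObj X
  zero := Iso.refl _
  succ
    | 0 => λ_ X
    | _ + 1 => Iso.refl _

theorem standard_oneIso_hom (X : C) : (standard X).oneIso.hom = 𝟙 X := by
  change (λ_ X).inv ≫ 𝟙 (𝟙_ C) ▷ X ≫ (λ_ X).hom = 𝟙 X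
  simp

/-- Only unitors and an associator remain, and they cancel by the triangle identity. This is the
condition `φ_{n,1} = id` for `n ≥ 1`. -/
theorem standard_tensorIso_one_hom (X : C) (n : ℕ) :
    ((standard X).tensorIso (n + 1) 1).hom = 𝟙 _ := by
  change ((standard X).obj (n + 1)) ◁ (λ_ X).inv ≫ (α_ _ _ _).inv ≫
    ((standard X).obj (n + 1) ◁ 𝟙 (𝟙_ C) ≫ (ρ_ _).hom) ▷ X ≫ 𝟙 _ = _
  simp
  rfl

end TensorPowers

namespace SymmMonFunctor

open Opposite TensorPowers FinCospan

variable {C : Type u} [Category.{v} C] [MonoidalCategory C] [SymmetricCategory C]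

theorem exists_isPowerStrict_frobeniusData_eq (S : FrobeniusData C) (hS : S.IsSpecialCommutative) :
    ∃ F : SymmMonFunctor FinCospan C, F.IsPowerStrict ∧ F.frobeniusData = S := by
  obtain ⟨X, mul, unit, comul, counit⟩ := S
  obtain ⟨h₁, h₂, h₃, h₄, h₅, h₆, h₇, h₈, h₉⟩ := hS
  dsimp only at h₁ h₂ h₃ h₄ h₅ h₆ h₇ h₈ h₉
  let _ : MonObj X :=
    { one := unit
      mul := mul
      one_mul := h₂
      -- The right unit law follows from the left one by commutativity; the same holds below for the
      -- counit.
      mul_one := by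
        rw [← h₃, BraidedCategory.braiding_naturality_right_assoc, h₂, braiding_leftUnitor]
      mul_assoc := h₁ }
  have : IsCommMonObj X := ⟨h₃⟩
  let _ : MonObj (op X) :=
    { one := counit.op
      mul := comul.op
      one_mul := Quiver.Hom.unop_inj h₅
      mul_one := Quiver.Hom.unop_inj (by
        change comul ≫ X ◁ counit = (ρ_ X).inv
        rw [← h₆, Category.assoc, ← BraidedCategory.braiding_naturality_left, reassoc_of% h₅,
          leftUnitor_inv_braiding])
      mul_assoc := Quiver.Hom.unop_inj (by
        change comul ≫ comul ▷ X = (comul ≫ X ◁ comul) ≫ (α_ X X X).inv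
        rw [← h₄]; simp) }
  have : IsCommMonObj (op X) := ⟨Quiver.Hom.unop_inj h₆⟩
  have : IsSpecialFrobenius X := ⟨h₇, h₉⟩
  refine ⟨(standard X).cospanSymmMonFunctor, ⟨⟨rfl, rfl⟩, fun n hn => ?_⟩, ?_⟩
  · obtain ⟨n, rfl⟩ := Nat.exists_eq_add_of_le' hn
    exact ⟨rfl, standard_tensorIso_one_hom X n⟩
  · exact (((standard X).isHom_oneIso).eq_of_eqToHom rfl (standard_oneIso_hom X)).symm

end SymmMonFunctor

/-! ### The Frobenius monoid `1` in the category of cospans, and images of Frobenius monoids. -/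

namespace FinCospan

/-- The composite of two cospans with connected pushout. -/
theorem comp_cls_eq_spider {m n k : ℕ} {A B : Type} [Finite A] [Finite B] [Nonempty A]
    (f : Fin m → A) (g : Fin n → A) (h : Fin n → B) (l : Fin k → B)
    (H : ∀ (T : Type) (a : A → T) (b : B → T), (∀ s, a (g s) = b (h s)) →
      ∃ t, (∀ x, a x = t) ∧ ∀ x, b x = t) :
    comp (cls A f g) (cls B h l) = spider m k :=
  comp_cls (P := Fin 1) (i := fun _ => 0) (j := fun _ => 0)
    { comm := fun _ => rfl
      desc := fun T a b hab => by
        obtain ⟨t, h₁, h₂⟩ := H T a b hab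
        exact ⟨fun _ => t, fun x => (h₁ x).symm, fun x => (h₂ x).symm⟩
      surj := fun x => Or.inl ⟨Classical.arbitrary A, Subsingleton.elim _ _⟩ }

theorem comp_spider {m n k : ℕ} {A : Type} [Finite A] [Nonempty A] (f : Fin m → A) (g : Fin n → A)
    (hg : Function.Surjective g) : comp (cls A f g) (spider n k) = spider m k :=
  comp_cls_eq_spider f g _ _ fun T a b hab => by
    refine ⟨b 0, fun x => ?_, fun _ => congrArg b (Subsingleton.elim _ _)⟩
    obtain ⟨s, rfl⟩ := hg x
    exact hab s

theorem spider_comp {m n k : ℕ} {A : Type} [Finite A] (f : Fin n → A) (g : Fin k → A)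
    (hf : Function.Surjective f) : comp (spider m n) (cls A f g) = spider m k :=
  comp_cls_eq_spider _ _ f g fun T a b hab => by
    refine ⟨a 0, fun _ => congrArg a (Subsingleton.elim _ _), fun x => ?_⟩
    obtain ⟨s, rfl⟩ := hf x
    exact (hab s).symm

theorem sumMap_surjective {m n : ℕ} {A B : Type} {f : Fin m → A} {g : Fin n → B}
    (hf : Function.Surjective f) (hg : Function.Surjective g) :
    Function.Surjective (sumMap f g) :=
  (hf.sumMap hg).comp finSumFinEquiv.symm.surjective

theorem surjective_to_one {n : ℕ} (f : Fin (n + 1) → Fin 1) : Function.Surjective f :=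
  fun _ => ⟨0, Subsingleton.elim _ _⟩

theorem ofFun_comp_spider {m n k : ℕ} (f : Fin m → Fin n) :
    comp (ofFun f) (spider n k) = spider m k := ofFun_comp_cls _ _ _

theorem spider_comp_ofFun {m n k : ℕ} (e : Fin n ≃ Fin k) :
    comp (spider m n) (ofFun e) = spider m k := cls_comp_ofFun _ _ _

theorem ofFun_eq_spider {m : ℕ} (f : Fin m → Fin 1) : ofFun f = spider m 1 :=
  cls_eq_cls (Equiv.refl _) (fun _ => Subsingleton.elim _ _) (fun _ => Subsingleton.elim _ _)

/-- The special commutative Frobenius monoid `1` in the category of cospans. -/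
noncomputable def frobeniusData : FrobeniusData FinCospan where
  X := ⟨1⟩
  mul := spider 2 1
  unit := spider 0 1
  comul := spider 1 2
  counit := spider 1 0

/-- All composites involved have connected pushouts, so each side of each equation is the spider of
its type; the identity of `1` and the unitors at `1` are spiders too. -/
theorem frobeniusData_isSpecialCommutative : frobeniusData.IsSpecialCommutative where
  assoc := by
    change comp (m := 3) (n := 2) (tensor
      (spider 2 1 : CHom 2 1) (ofFun (id : Fin 1 → Fin 1))) (spider 2 1) =
      comp (n := 3) (ofFun _) (comp (n := 2) (tensor (ofFun (id : Fin 1 → Fin 1))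
        (spider 2 1 : CHom 2 1)) (spider 2 1))
    simp only [ofFun, spider, tensor_cls]
    refine
      (comp_spider _ _ (sumMap_surjective (surjective_to_one _) (surjective_to_one _))).trans ?_
    refine Eq.trans ?_ (congrArg (comp _) (comp_spider _ _
      (sumMap_surjective (surjective_to_one _) (surjective_to_one _))).symm)
    exact (ofFun_comp_spider _).symm
  unit_mul := by
    change comp (m := 1) (n := 2) (tensor (m := 0) (n := 1)
      (spider 0 1) (ofFun (id : Fin 1 → Fin 1))) (spider 2 1) = ofFun _
    refine Eq.trans ?_ (ofFun_eq_spider (m := 1) _).symm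
    simp only [ofFun, spider, tensor_cls]
    exact comp_spider _ _ (sumMap_surjective (surjective_to_one _) (surjective_to_one _))
  comm := ofFun_comp_spider _
  coassoc := by
    change comp (n := 2) (k := 3) (spider 1 2) (comp (tensor (m := 1) (n := 2)
      (spider 1 2) (ofFun (id : Fin 1 → Fin 1))) (ofFun _)) =
      comp (n := 2) (spider 1 2) (tensor (ofFun (id : Fin 1 → Fin 1)) (spider 1 2 : CHom 1 2))
    rw [← comp_assoc]
    simp only [ofFun, spider, tensor_cls]
    refine Eq.trans ?_ (spider_comp _ _
      (sumMap_surjective (surjective_to_one _) (surjective_to_one _))).symm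
    refine (congrArg (comp · _) (spider_comp _ _
      (sumMap_surjective (surjective_to_one _) (surjective_to_one _)))).trans ?_
    exact spider_comp_ofFun (finCongr _)
  comul_counit := by
    change comp (n := 2) (k := 1) (spider 1 2) (tensor (m := 1) (n := 0)
      (spider 1 0) (ofFun (id : Fin 1 → Fin 1))) = ofFun _
    refine Eq.trans ?_ (ofFun_eq_spider (m := 1) _).symm
    simp only [ofFun, spider, tensor_cls]
    exact spider_comp _ _ (sumMap_surjective (surjective_to_one _) (surjective_to_one _))
  cocomm := spider_comp_ofFun (swapEquiv 1 1)
  frobenius_left := by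
    change comp (m := 2) (n := 3) (k := 2) (tensor (m := 1) (n := 2)
      (spider 1 2) (ofFun (id : Fin 1 → Fin 1)))
      (comp (ofFun (finCongr _)) (tensor (ofFun (id : Fin 1 → Fin 1)) (spider 2 1 : CHom 2 1))) =
      comp (n := 1) (spider 2 1) (spider 1 2)
    refine Eq.trans ?_ (comp_spider _ _ (surjective_to_one _)).symm
    simp only [ofFun, spider, tensor_cls]
    refine (congrArg (comp _) (ofFun_comp_cls _ _ _)).trans (comp_cls_eq_spider _ _ _ _ ?_)
    intro T a b hab
    -- The three points of the middle foot link the four points of the two apexes into a chain, so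
    -- the pushout is a point.
    have h₀ : a (.inl 0) = b (.inl 0) := hab (0 : Fin 3)
    have h₁ : a (.inl 0) = b (.inr 0) := hab (1 : Fin 3)
    have h₂ : a (.inr 0) = b (.inr 0) := hab (2 : Fin 3)
    refine ⟨a (.inl 0), ?_, ?_⟩ <;> rintro (x | x) <;> rw [Subsingleton.elim x 0]
    · exact h₂.trans h₁.symm
    · exact h₀.symm
    · exact h₁.symm
  frobenius_right := by
    change comp (m := 2) (n := 3) (k := 2) (tensor (ofFun (id : Fin 1 → Fin 1))
      (spider 1 2 : CHom 1 2))
      (comp (ofFun (finCongr _).symm) (tensor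
        (spider 2 1 : CHom 2 1) (ofFun (id : Fin 1 → Fin 1)))) =
      comp (n := 1) (spider 2 1) (spider 1 2)
    refine Eq.trans ?_ (comp_spider _ _ (surjective_to_one _)).symm
    simp only [ofFun, spider, tensor_cls]
    refine (congrArg (comp _) (ofFun_comp_cls _ _ _)).trans (comp_cls_eq_spider _ _ _ _ ?_)
    intro T a b hab
    have h₀ : a (.inl 0) = b (.inl 0) := hab (0 : Fin 3)
    have h₁ : a (.inr 0) = b (.inl 0) := hab (1 : Fin 3)
    have h₂ : a (.inr 0) = b (.inr 0) := hab (2 : Fin 3)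
    refine ⟨a (.inl 0), ?_, ?_⟩ <;> rintro (x | x) <;> rw [Subsingleton.elim x 0]
    · exact h₁.trans h₀.symm
    · exact h₀.symm
    · exact h₂.symm.trans (h₁.trans h₀.symm)
  special := by
    change comp (spider 1 2) (spider 2 1) = ofFun _
    exact (comp_spider _ _ (surjective_to_one _)).trans (ofFun_eq_spider _).symm

end FinCospan

namespace SymmMonFunctor

open CategoryTheory.Functor.LaxMonoidal CategoryTheory.Functor.OplaxMonoidal

/-- The image of a Frobenius monoid under a symmetric monoidal functor. -/
def mapFrobeniusData {D : Type*} [Category* D] [MonoidalCategory D] [SymmetricCategory D]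
    {C : Type*} [Category* C] [MonoidalCategory C] [SymmetricCategory C]
    (F : SymmMonFunctor D C) (S : FrobeniusData D) : FrobeniusData C where
  X := F.toFunctor.obj S.X
  mul := μ F.toFunctor S.X S.X ≫ F.toFunctor.map S.mul
  unit := ε F.toFunctor ≫ F.toFunctor.map S.unit
  comul := F.toFunctor.map S.comul ≫ δ F.toFunctor S.X S.X
  counit := F.toFunctor.map S.counit ≫ η F.toFunctor

/-- In each case the functor is applied to the equation, and composing with the coherence morphisms
at the source or target cancels those introduced by rewriting images of whiskerings, associators and
unitors. -/
theorem mapFrobeniusData_isSpecialCommutative {D : Type*} [Category* D] [MonoidalCategory D]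
    [SymmetricCategory D] {C : Type*} [Category* C] [MonoidalCategory C] [SymmetricCategory C]
    (F : SymmMonFunctor D C) {S : FrobeniusData D} (hS : S.IsSpecialCommutative) :
    (F.mapFrobeniusData S).IsSpecialCommutative where
  assoc := by
    have h := congrArg F.toFunctor.map hS.assoc
    simp only [Functor.map_comp, Functor.Monoidal.map_whiskerRight,
      Functor.Monoidal.map_whiskerLeft, Functor.Monoidal.map_associator] at h
    dsimp only [mapFrobeniusData]
    have h' := congrArg (fun t =>
      μ F.toFunctor S.X S.X ▷ (F.toFunctor.obj S.X) ≫ μ F.toFunctor (S.X ⊗ S.X) S.X ≫ t) h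
    simpa using h'
  unit_mul := by
    have h := congrArg F.toFunctor.map hS.unit_mul
    simp only [Functor.map_comp, Functor.Monoidal.map_whiskerRight,
      Functor.Monoidal.map_leftUnitor] at h
    dsimp only [mapFrobeniusData]
    have h' := congrArg (fun t =>
      ε F.toFunctor ▷ (F.toFunctor.obj S.X) ≫ μ F.toFunctor (𝟙_ D) S.X ≫ t) h
    simpa using h'
  comm := by
    have h := congrArg F.toFunctor.map hS.comm
    simp only [Functor.map_comp, Functor.map_braiding] at h
    dsimp only [mapFrobeniusData]
    have h' := congrArg (fun t => μ F.toFunctor S.X S.X ≫ t) h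
    simpa using h'
  coassoc := by
    have h := congrArg F.toFunctor.map hS.coassoc
    simp only [Functor.map_comp, Functor.Monoidal.map_whiskerRight,
      Functor.Monoidal.map_whiskerLeft, Functor.Monoidal.map_associator] at h
    dsimp only [mapFrobeniusData]
    have h' := congrArg (fun t =>
      t ≫ δ F.toFunctor S.X (S.X ⊗ S.X) ≫ (F.toFunctor.obj S.X) ◁ δ F.toFunctor S.X S.X) h
    simpa using h'
  comul_counit := by
    have h := congrArg F.toFunctor.map hS.comul_counit
    simp only [Functor.map_comp, Functor.Monoidal.map_whiskerRight,
      Functor.Monoidal.map_leftUnitor_inv] at h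
    dsimp only [mapFrobeniusData]
    have h' := congrArg (fun t =>
      t ≫ δ F.toFunctor (𝟙_ D) S.X ≫ η F.toFunctor ▷ (F.toFunctor.obj S.X)) h
    simpa using h'
  cocomm := by
    have h := congrArg F.toFunctor.map hS.cocomm
    simp only [Functor.map_comp, Functor.map_braiding] at h
    dsimp only [mapFrobeniusData]
    have h' := congrArg (fun t => t ≫ δ F.toFunctor S.X S.X) h
    simpa using h'
  frobenius_left := by
    have h := congrArg F.toFunctor.map hS.frobenius_left
    simp only [Functor.map_comp, Functor.Monoidal.map_whiskerRight,
      Functor.Monoidal.map_whiskerLeft, Functor.Monoidal.map_associator] at h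
    dsimp only [mapFrobeniusData]
    have h' := congrArg (fun t => μ F.toFunctor S.X S.X ≫ t ≫ δ F.toFunctor S.X S.X) h
    simpa only [Category.assoc, Functor.Monoidal.μ_δ_assoc, Functor.Monoidal.μ_δ,
      comp_whiskerRight, whiskerLeft_comp, Category.comp_id] using h'
  frobenius_right := by
    have h := congrArg F.toFunctor.map hS.frobenius_right
    simp only [Functor.map_comp, Functor.Monoidal.map_whiskerRight,
      Functor.Monoidal.map_whiskerLeft, Functor.Monoidal.map_associator_inv] at h
    dsimp only [mapFrobeniusData]
    have h' := congrArg (fun t => μ F.toFunctor S.X S.X ≫ t ≫ δ F.toFunctor S.X S.X) h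
    simpa only [Category.assoc, Functor.Monoidal.μ_δ_assoc, Functor.Monoidal.μ_δ,
      comp_whiskerRight, whiskerLeft_comp, Category.comp_id] using h'
  special := by
    have h := congrArg F.toFunctor.map hS.special
    simp only [Functor.map_comp] at h
    dsimp only [mapFrobeniusData]
    have h' := congrArg (fun t => t) h
    simpa using h'

end SymmMonFunctor

/-! ### Generators of the category of cospans. -/

namespace FinCospan

/-- The functions of finite sets are generated under composition and sums by the functions
`0 → 1` and `2 → 1` and the exchange of two points. -/
theorem function_induction {P : ∀ {m n : ℕ}, (Fin m → Fin n) → Prop}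
    (h_id : ∀ n, P (id : Fin n → Fin n))
    (h_comp : ∀ {m n k : ℕ} {f : Fin m → Fin n} {g : Fin n → Fin k}, P f → P g → P (g ∘ f))
    (h_sum : ∀ {m n m' n' : ℕ} {f : Fin m → Fin n} {g : Fin m' → Fin n'}, P f → P g →
      P (finSumFinEquiv ∘ sumMap f g))
    (h_swap : P (swapEquiv 1 1)) (h_fold : P (fun _ => 0 : Fin 2 → Fin 1))
    (h_empty : P (fun _ => 0 : Fin 0 → Fin 1)) {m n : ℕ} (f : Fin m → Fin n) : P f := by
  -- The function that sends an extra last point to `k`. If `k` is the last point of the target, it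
  -- is a sum with `2 → 1`; otherwise exchanging the last two points of the source reduces it to a
  -- smaller case.
  have h_last : ∀ (n : ℕ) (k : Fin n),
      P (fun x : Fin (n + 1) => if h : x.val < n then ⟨x, h⟩ else k) := by
    intro n
    induction n with
    | zero => exact fun k => k.elim0
    | succ n ih =>
      intro k
      induction k using Fin.lastCases with
      | last =>
        convert h_sum (h_id n) h_fold using 1
        ext x
        rw [Function.comp_apply, val_sumMap_eq]
        have := x.isLt
        split_ifs <;> simp at * <;> omega
      | cast k =>
        have h₁ := h_sum (h_id n) h_swap
        have h₂ := h_sum (ih k) (h_id 1)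
        convert h_comp (m := n + 2) (n := n + 2) (k := n + 1) h₁ h₂ using 1
        ext x
        simp only [Function.comp_apply, val_sumMap_eq, val_swapEquiv, apply_dite Fin.val, id]
        have := x.isLt
        have := k.isLt
        split_ifs <;> (try simp only [Fin.val_castSucc]) <;> omega
  induction m with
  | zero =>
    induction n with
    | zero => convert h_id 0
    | succ n ih => convert h_sum (ih Fin.elim0) h_empty
  | succ m ih =>
    -- The last point is first sent to a new point of the target, which is then collapsed onto its
    -- true image.
    have h := h_comp (h_sum (ih (f ∘ Fin.castSucc)) (h_id 1)) (h_last n (f (Fin.last m)))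
    convert h using 1
    ext x
    induction x using Fin.lastCases with
    | last => simp [val_sumMap_eq]
    | cast x => simp [val_sumMap_eq]

/-- The cospan `Fin n = Fin n ← Fin m` of a function. -/
noncomputable def ofFunOp {m n : ℕ} (f : Fin m → Fin n) : CHom n m := cls (Fin n) id f

theorem ofFunOp_comp_ofFunOp {m n k : ℕ} (f : Fin m → Fin n) (g : Fin n → Fin k) :
    comp (ofFunOp g) (ofFunOp f) = ofFunOp (g ∘ f) :=
  comp_cls (i := id) (j := g)
    { comm := fun _ => rfl
      desc := fun _ a _ hab => ⟨a, fun _ => rfl, hab⟩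
      surj := fun x => Or.inl ⟨x, rfl⟩ }

theorem tensor_ofFunOp {m n m' n' : ℕ} (f : Fin m → Fin n) (g : Fin m' → Fin n') :
    tensor (ofFunOp f) (ofFunOp g) = ofFunOp (finSumFinEquiv ∘ sumMap f g) := by
  refine (tensor_cls id f id g).trans (cls_eq_cls finSumFinEquiv (fun x => ?_) (fun x => rfl))
  simp [sumMap]

theorem ofFun_comp_ofFunOp {m n p : ℕ} (f : Fin m → Fin p) (g : Fin n → Fin p) :
    comp (ofFun f) (ofFunOp g) = cls (Fin p) f g := ofFun_comp_cls f id g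

theorem ofFunOp_equiv {m n : ℕ} (e : Fin m ≃ Fin n) : ofFunOp e = ofFun e.symm :=
  cls_eq_cls e.symm (fun _ => rfl) (fun x => by simp)

theorem ofFunOp_eq_spider {m : ℕ} (f : Fin m → Fin 1) : ofFunOp f = spider 1 m :=
  cls_eq_cls (Equiv.refl _) (fun _ => Subsingleton.elim _ _) (fun _ => Subsingleton.elim _ _)

/-- The category of cospans is generated by the Frobenius structure of the object `1` and the
exchange of two points. -/
theorem hom_induction {W : ∀ {m n : ℕ}, CHom m n → Prop}
    (h_id : ∀ n, W (ofFun (id : Fin n → Fin n)))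
    (h_comp : ∀ {m n k : ℕ} {c : CHom m n} {d : CHom n k}, W c → W d → W (comp c d))
    (h_tensor : ∀ {m n m' n' : ℕ} {c : CHom m n} {d : CHom m' n'}, W c → W d → W (tensor c d))
    (h_swap : W (ofFun (swapEquiv 1 1))) (h_mul : W (spider 2 1)) (h_unit : W (spider 0 1))
    (h_comul : W (spider 1 2)) (h_counit : W (spider 1 0)) {m n : ℕ} (c : CHom m n) : W c := by
  obtain ⟨p, f, g, rfl⟩ := c.ind
  -- Both legs are built from the generating functions: `2 → 1` and `0 → 1` read forwards give
  -- `spider 2 1` and `spider 0 1`, read backwards `spider 1 2` and `spider 1 0`.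
  rw [← ofFun_comp_ofFunOp]
  refine h_comp (function_induction (P := fun f => W (ofFun f)) h_id ?_ ?_ h_swap ?_ ?_ f)
    (function_induction (P := fun f => W (ofFunOp f)) h_id ?_ ?_ ?_ ?_ ?_ g)
  · intro _ _ _ f g hf hg
    rw [← ofFun_comp_ofFun]
    exact h_comp hf hg
  · intro _ _ _ _ f g hf hg
    rw [← tensor_ofFun]
    exact h_tensor hf hg
  · rwa [ofFun_eq_spider]
  · rwa [ofFun_eq_spider]
  · intro _ _ _ f g hf hg
    rw [← ofFunOp_comp_ofFunOp]
    exact h_comp hg hf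
  · intro _ _ _ _ f g hf hg
    rw [← tensor_ofFunOp]
    exact h_tensor hf hg
  · rw [ofFunOp_equiv]
    exact h_swap
  · rwa [ofFunOp_eq_spider]
  · rwa [ofFunOp_eq_spider]

end FinCospan

/-! ### Comparison of two symmetric monoidal functors out of the category of cospans. -/

namespace SymmMonFunctor

open CategoryTheory.Functor.LaxMonoidal CategoryTheory.Functor.OplaxMonoidal

section

variable {C : Type u} [Category.{v} C] [MonoidalCategory C] [SymmetricCategory C]
  {F G : SymmMonFunctor FinCospan C}
  (θ : ∀ a : FinCospan, F.toFunctor.obj a ⟶ G.toFunctor.obj a)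

/-- Holds for any family `θ`. As the cospan category is strict, it covers the associators and
unitors before `θ` is known to be natural. -/
theorem naturality_of_eqToHom {a b : FinCospan} {f : a ⟶ b} (h : ∃ h : a = b, f = eqToHom h) :
    F.toFunctor.map f ≫ θ b = θ a ≫ G.toFunctor.map f := by
  obtain ⟨rfl, rfl⟩ := h
  simp

variable {θ}

theorem μ_naturality_unit_left (hε : ε F.toFunctor ≫ θ (𝟙_ FinCospan) = ε G.toFunctor)
    (n : FinCospan) :
    (θ (𝟙_ _) ⊗ₘ θ n) ≫ μ G.toFunctor (𝟙_ _) n = μ F.toFunctor (𝟙_ _) n ≫ θ (𝟙_ _ ⊗ n) := by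
  have h := naturality_of_eqToHom θ (FinCospan.isStrictMonoidal.leftUnitor n)
  rw [← cancel_mono (G.toFunctor.map (λ_ n).hom), ← cancel_epi (ε F.toFunctor ▷ _)]
  simp only [Category.assoc, ← h]
  rw [← Functor.LaxMonoidal.left_unitality_assoc, MonoidalCategory.tensorHom_def, Category.assoc,
    ← comp_whiskerRight_assoc, hε, ← whisker_exchange_assoc, ← Functor.LaxMonoidal.left_unitality,
    leftUnitor_naturality]

theorem μ_naturality_unit_right (hε : ε F.toFunctor ≫ θ (𝟙_ FinCospan) = ε G.toFunctor)
    (n : FinCospan) :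
    (θ n ⊗ₘ θ (𝟙_ _)) ≫ μ G.toFunctor n (𝟙_ _) = μ F.toFunctor n (𝟙_ _) ≫ θ (n ⊗ 𝟙_ _) := by
  have h := naturality_of_eqToHom θ (FinCospan.isStrictMonoidal.rightUnitor n)
  rw [← cancel_mono (G.toFunctor.map (ρ_ n).hom), ← cancel_epi (_ ◁ ε F.toFunctor)]
  simp only [Category.assoc, ← h]
  rw [← Functor.LaxMonoidal.right_unitality_assoc, tensorHom_def', Category.assoc,
    ← whiskerLeft_comp_assoc, hε, whisker_exchange_assoc, ← Functor.LaxMonoidal.right_unitality,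
    rightUnitor_naturality]

/-- Induction on the second argument: associativity expresses `μ` at `(a, n + 1)` through `μ` at
`(n, 1)`, `(a, n)` and `(a + n, 1)`. Unitality handles the cases with an argument `0`, which `hμ`
leaves out. -/
theorem μ_naturality_of_one (hε : ε F.toFunctor ≫ θ (𝟙_ FinCospan) = ε G.toFunctor)
    (hμ : ∀ n : ℕ, 1 ≤ n → (θ ⟨n⟩ ⊗ₘ θ ⟨1⟩) ≫ μ G.toFunctor ⟨n⟩ ⟨1⟩ =
      μ F.toFunctor ⟨n⟩ ⟨1⟩ ≫ θ (⟨n⟩ ⊗ ⟨1⟩)) (a b : FinCospan) :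
    (θ a ⊗ₘ θ b) ≫ μ G.toFunctor a b = μ F.toFunctor a b ≫ θ (a ⊗ b) := by
  obtain ⟨n⟩ := b
  induction n with
  | zero => exact μ_naturality_unit_right hε a
  | succ n ih =>
    have hn : (θ ⟨n⟩ ⊗ₘ θ ⟨1⟩) ≫ μ G.toFunctor ⟨n⟩ ⟨1⟩ =
        μ F.toFunctor ⟨n⟩ ⟨1⟩ ≫ θ (⟨n⟩ ⊗ ⟨1⟩) := by
      cases n with
      | zero => exact μ_naturality_unit_left hε ⟨1⟩
      | succ n => exact hμ _ (Nat.le_add_left _ _)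
    have ha : (θ (a ⊗ ⟨n⟩) ⊗ₘ θ ⟨1⟩) ≫ μ G.toFunctor (a ⊗ ⟨n⟩) ⟨1⟩ =
        μ F.toFunctor (a ⊗ ⟨n⟩) ⟨1⟩ ≫ θ ((a ⊗ ⟨n⟩) ⊗ ⟨1⟩) := by
      obtain ⟨m⟩ := a
      by_cases h : 1 ≤ m + n
      · exact hμ (m + n) h
      · obtain ⟨rfl, rfl⟩ : m = 0 ∧ n = 0 := by omega
        exact μ_naturality_unit_left hε ⟨1⟩
    have h := naturality_of_eqToHom θ (FinCospan.isStrictMonoidal.associator a ⟨n⟩ ⟨1⟩)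
    change (θ a ⊗ₘ θ (⟨n⟩ ⊗ ⟨1⟩)) ≫ μ G.toFunctor a (⟨n⟩ ⊗ ⟨1⟩) =
      μ F.toFunctor a (⟨n⟩ ⊗ ⟨1⟩) ≫ θ (a ⊗ ⟨n⟩ ⊗ ⟨1⟩)
    rw [← cancel_epi (_ ◁ μ F.toFunctor ⟨n⟩ ⟨1⟩), whiskerLeft_μ_comp_μ_assoc, h]
    have h₁ : (F.toFunctor.obj a ◁ μ F.toFunctor ⟨n⟩ ⟨1⟩) ≫ (θ a ⊗ₘ θ (⟨n⟩ ⊗ ⟨1⟩)) =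
        (θ a ⊗ₘ θ ⟨n⟩ ⊗ₘ θ ⟨1⟩) ≫ (G.toFunctor.obj a ◁ μ G.toFunctor ⟨n⟩ ⟨1⟩) := by
      rw [← id_tensorHom, ← id_tensorHom, tensorHom_comp_tensorHom, tensorHom_comp_tensorHom,
        Category.id_comp, Category.comp_id, hn]
    have h₂ : (μ F.toFunctor a ⟨n⟩ ▷ F.toFunctor.obj ⟨1⟩) ≫ (θ (a ⊗ ⟨n⟩) ⊗ₘ θ ⟨1⟩) =
        ((θ a ⊗ₘ θ ⟨n⟩) ⊗ₘ θ ⟨1⟩) ≫ (μ G.toFunctor a ⟨n⟩ ▷ G.toFunctor.obj ⟨1⟩) := by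
      rw [← tensorHom_id, ← tensorHom_id, tensorHom_comp_tensorHom, tensorHom_comp_tensorHom,
        Category.id_comp, Category.comp_id, ih]
    rw [reassoc_of% h₁, whiskerLeft_μ_comp_μ, ← reassoc_of% ha, reassoc_of% h₂,
      associator_inv_naturality_assoc]

/-- The morphisms at which `θ` is natural are closed under composition and, by `hμ`, under sums.
They contain the exchange of two points because `F` and `G` are braided, and the four Frobenius
cospans by `hθ`. -/
theorem naturality_of_isHom (hμ : ∀ a b : FinCospan,
      (θ a ⊗ₘ θ b) ≫ μ G.toFunctor a b = μ F.toFunctor a b ≫ θ (a ⊗ b))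
    (hε : ε F.toFunctor ≫ θ (𝟙_ FinCospan) = ε G.toFunctor)
    (hθ : F.frobeniusData.IsHom G.frobeniusData (θ ⟨1⟩)) {a b : FinCospan} (f : a ⟶ b) :
    F.toFunctor.map f ≫ θ b = θ a ≫ G.toFunctor.map f := by
  refine FinCospan.hom_induction (W := fun {m n} (f : (⟨m⟩ : FinCospan) ⟶ ⟨n⟩) =>
    F.toFunctor.map f ≫ θ ⟨n⟩ = θ ⟨m⟩ ≫ G.toFunctor.map f) (fun n => ?_) ?_ ?_ ?_ ?_ ?_ ?_ ?_ f
  · exact naturality_of_eqToHom θ ⟨rfl, rfl⟩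
  · intro m n k c d hc hd
    have hF := F.toFunctor.map_comp (X := ⟨m⟩) (Y := ⟨n⟩) (Z := ⟨k⟩) c d
    have hG := G.toFunctor.map_comp (X := ⟨m⟩) (Y := ⟨n⟩) (Z := ⟨k⟩) c d
    refine (congrArg (· ≫ _) hF).trans (Eq.trans ?_ (congrArg (_ ≫ ·) hG).symm)
    rw [Category.assoc, hd, reassoc_of% hc]
  · intro m n m' n' c d hc hd
    change F.toFunctor.map ((c : (⟨m⟩ : FinCospan) ⟶ ⟨n⟩) ⊗ₘ (d : (⟨m'⟩ : FinCospan) ⟶ ⟨n'⟩)) ≫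
      θ (⟨n⟩ ⊗ ⟨n'⟩) = θ (⟨m⟩ ⊗ ⟨m'⟩) ≫ G.toFunctor.map
        ((c : (⟨m⟩ : FinCospan) ⟶ ⟨n⟩) ⊗ₘ (d : (⟨m'⟩ : FinCospan) ⟶ ⟨n'⟩))
    rw [← cancel_epi (μ F.toFunctor _ _), ← μ_natural_assoc, ← hμ, ← reassoc_of% hμ, ← μ_natural,
      tensorHom_comp_tensorHom_assoc, tensorHom_comp_tensorHom_assoc, hc, hd]
  · change F.toFunctor.map (β_ (⟨1⟩ : FinCospan) ⟨1⟩).hom ≫ θ (⟨1⟩ ⊗ ⟨1⟩) =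
      θ (⟨1⟩ ⊗ ⟨1⟩) ≫ G.toFunctor.map (β_ (⟨1⟩ : FinCospan) ⟨1⟩).hom
    rw [← cancel_epi (μ F.toFunctor _ _), Functor.LaxBraided.braided_assoc, ← hμ,
      ← reassoc_of% hμ, Functor.LaxBraided.braided, BraidedCategory.braiding_naturality_assoc]
  · have h := hθ.mul
    simp only [frobeniusData] at h
    rw [reassoc_of% hμ, Category.assoc, cancel_epi] at h
    exact h.symm
  · have h := hθ.unit
    simp only [frobeniusData] at h
    rw [← hε, Category.assoc, Category.assoc, cancel_epi] at h
    exact h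
  · have h := congrArg (· ≫ μ G.toFunctor ⟨1⟩ ⟨1⟩) hθ.comul
    simp only [frobeniusData, Category.assoc, hμ, Functor.Monoidal.δ_μ,
      Functor.Monoidal.δ_μ_assoc] at h
    exact h.symm.trans (congrArg (_ ≫ ·) (Category.comp_id _))
  · have h := congrArg (· ≫ ε G.toFunctor) hθ.counit
    simp only [frobeniusData, Category.assoc, Functor.Monoidal.η_ε] at h
    rw [← hε, Functor.Monoidal.η_ε_assoc] at h
    exact h.symm.trans (congrArg (_ ≫ ·) (Category.comp_id _))

end

end SymmMonFunctor

/-! ### Injectivity, and the case of a strict target. -/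

section IsEqToHom

/-- A morphism is the identity up to an equality of its source and target. -/
def IsEqToHom {C : Type*} [Category* C] {X Y : C} (f : X ⟶ Y) : Prop := ∃ h : X = Y, f = eqToHom h

namespace IsEqToHom

variable {C : Type*} [Category* C] {X Y Z : C}

theorem comp {f : X ⟶ Y} {g : Y ⟶ Z} (hf : IsEqToHom f) (hg : IsEqToHom g) :
    IsEqToHom (f ≫ g) := by
  obtain ⟨rfl, rfl⟩ := hf
  rwa [eqToHom_refl, Category.id_comp]

theorem inv {e : X ≅ Y} (he : IsEqToHom e.hom) : IsEqToHom e.inv := by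
  obtain ⟨rfl, he⟩ := he
  exact ⟨rfl, by rw [← cancel_epi e.hom, Iso.hom_inv_id, he]; simp⟩

theorem of_comp_left {f : X ⟶ Y} {g : Y ⟶ Z} (hf : IsEqToHom f) (h : IsEqToHom (f ≫ g)) :
    IsEqToHom g := by
  obtain ⟨rfl, rfl⟩ := hf
  rwa [eqToHom_refl, Category.id_comp] at h

theorem of_comp_right {f : X ⟶ Y} {g : Y ⟶ Z} (hg : IsEqToHom g) (h : IsEqToHom (f ≫ g)) :
    IsEqToHom f := by
  obtain ⟨rfl, rfl⟩ := hg
  rwa [eqToHom_refl, Category.comp_id] at h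

theorem map {D : Type*} [Category* D] (F : C ⥤ D) {f : X ⟶ Y} (hf : IsEqToHom f) :
    IsEqToHom (F.map f) := by
  obtain ⟨rfl, rfl⟩ := hf
  exact ⟨rfl, F.map_id X⟩

theorem whiskerLeft [MonoidalCategory C] {f : X ⟶ Y} (hf : IsEqToHom f) (Z : C) :
    IsEqToHom (Z ◁ f) := by
  obtain ⟨rfl, rfl⟩ := hf
  exact ⟨rfl, whiskerLeft_id Z X⟩

theorem whiskerRight [MonoidalCategory C] {f : X ⟶ Y} (hf : IsEqToHom f) (Z : C) :
    IsEqToHom (f ▷ Z) := by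
  obtain ⟨rfl, rfl⟩ := hf
  exact ⟨rfl, id_whiskerRight X Z⟩

end IsEqToHom

end IsEqToHom

theorem eqToHom_tensorHom_eqToHom {C : Type u} [Category.{v} C] [MonoidalCategory C]
    {X Y X' Y' : C} (h : X = Y) (h' : X' = Y') :
    (eqToHom h ⊗ₘ eqToHom h') = eqToHom (by rw [h, h']) := by
  subst h h'
  simp

namespace SymmMonFunctor

open CategoryTheory.Functor.LaxMonoidal CategoryTheory.Functor.OplaxMonoidal

section

variable {D : Type*} [Category* D] [MonoidalCategory D] [SymmetricCategory D]
    {C : Type*} [Category* C] [MonoidalCategory C] [SymmetricCategory C]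

/-- Once the functors agree, only `ε` and `μ` remain to be compared, since a braided structure is
determined by its underlying lax monoidal structure. -/
theorem ext_of_eqToHom {F G : SymmMonFunctor D C}
    (hobj : ∀ a, F.toFunctor.obj a = G.toFunctor.obj a)
    (hmap : ∀ {a b : D} (f : a ⟶ b), F.toFunctor.map f ≫ eqToHom (hobj b) =
      eqToHom (hobj a) ≫ G.toFunctor.map f)
    (hε : ε F.toFunctor ≫ eqToHom (hobj (𝟙_ D)) = ε G.toFunctor)
    (hμ : ∀ a b : D, (eqToHom (hobj a) ⊗ₘ eqToHom (hobj b)) ≫ μ G.toFunctor a b =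
      μ F.toFunctor a b ≫ eqToHom (hobj (a ⊗ b))) : F = G := by
  obtain ⟨F, bF⟩ := F
  obtain ⟨G, bG⟩ := G
  obtain rfl : F = G := CategoryTheory.Functor.ext hobj fun a b f => by
    rw [← reassoc_of% hmap f]
    simp
  congr 1
  apply Functor.Braided.toMonoidal_injective
  apply Functor.Monoidal.toLaxMonoidal_injective
  ext
  · simpa using hε
  · simpa using (hμ _ _).symm

end

variable {C : Type u} [Category.{v} C] [MonoidalCategory C] [SymmetricCategory C]

theorem IsPowerStrict.obj_eq {F G : SymmMonFunctor FinCospan C} (hF : F.IsPowerStrict)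
    (hG : G.IsPowerStrict) (h : F.toFunctor.obj ⟨1⟩ = G.toFunctor.obj ⟨1⟩) :
    (n : ℕ) → F.toFunctor.obj ⟨n⟩ = G.toFunctor.obj ⟨n⟩
  | 0 => hF.1.1.symm.trans hG.1.1
  | 1 => h
  | n + 2 => by
    obtain ⟨h₁, -⟩ := hF.2 (n + 1) (Nat.le_add_left _ _)
    obtain ⟨h₂, -⟩ := hG.2 (n + 1) (Nat.le_add_left _ _)
    exact h₁.symm.trans (Eq.trans (by rw [IsPowerStrict.obj_eq hF hG h (n + 1), h]) h₂)

/-- Equal first powers give equal objects throughout. The resulting family of `eqToHom`s respects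
`ε` and each `μ` at `(n, 1)`, which are identities on both sides, hence every `μ`; it is then
natural since it respects the Frobenius data. -/
theorem injOn_frobeniusData :
    Set.InjOn (fun F : SymmMonFunctor FinCospan C => F.frobeniusData) {F | F.IsPowerStrict} := by
  intro F hF G hG h
  have hobj (a : FinCospan) : F.toFunctor.obj a = G.toFunctor.obj a :=
    hF.obj_eq hG (congrArg FrobeniusData.X h) a.card
  have hε : ε F.toFunctor ≫ eqToHom (hobj (𝟙_ FinCospan)) = ε G.toFunctor := by
    obtain ⟨_, h₁⟩ := hF.1
    obtain ⟨_, h₂⟩ := hG.1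
    rw [h₁, h₂, eqToHom_trans]
  have hμ := μ_naturality_of_one (θ := fun a => eqToHom (hobj a)) hε (fun n hn => by
    obtain ⟨_, h₁⟩ := hF.2 n hn
    obtain ⟨_, h₂⟩ := hG.2 n hn
    rw [h₁, h₂, eqToHom_tensorHom_eqToHom, eqToHom_trans, eqToHom_trans])
  exact ext_of_eqToHom hobj
    (naturality_of_isHom hμ hε (FrobeniusData.isHom_eqToHom h)) hε hμ

theorem IsStrict.isPowerStrict {F : SymmMonFunctor FinCospan C} (hF : F.IsStrict) :
    F.IsPowerStrict := ⟨hF.1, fun n _ => hF.2 ⟨n⟩ ⟨1⟩⟩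

/-- With strict source and target, unitality forces `μ` to be an identity when an argument is `0`,
and associativity propagates this from `(n, 1)` to all pairs by induction on the second argument. -/
theorem IsPowerStrict.isStrict {F : SymmMonFunctor FinCospan C} (hF : F.IsPowerStrict)
    (hC : IsStrictMonoidal C) : F.IsStrict := by
  have hε : IsEqToHom (ε F.toFunctor) := hF.1
  have hl (a : FinCospan) : IsEqToHom (μ F.toFunctor (𝟙_ _) a) := by
    have h : IsEqToHom (λ_ (F.toFunctor.obj a)).hom := hC.leftUnitor _
    rw [Functor.LaxMonoidal.left_unitality] at h
    exact .of_comp_right ((IsEqToHom.map _ (FinCospan.isStrictMonoidal.leftUnitor a)))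
      (.of_comp_left (hε.whiskerRight _) h)
  have hr (a : FinCospan) : IsEqToHom (μ F.toFunctor a (𝟙_ _)) := by
    have h : IsEqToHom (ρ_ (F.toFunctor.obj a)).hom := hC.rightUnitor _
    rw [Functor.LaxMonoidal.right_unitality] at h
    exact .of_comp_right ((IsEqToHom.map _ (FinCospan.isStrictMonoidal.rightUnitor a)))
      (.of_comp_left (hε.whiskerLeft _) h)
  have h₁ (n : ℕ) : IsEqToHom (μ F.toFunctor ⟨n⟩ ⟨1⟩) := by
    cases n with
    | zero => exact hl ⟨1⟩
    | succ n => exact hF.2 (n + 1) (Nat.le_add_left _ _)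
  refine ⟨hε, fun a b => ?_⟩
  obtain ⟨n⟩ := b
  induction n with
  | zero => exact hr a
  | succ n ih =>
    refine IsEqToHom.of_comp_left ((h₁ n).whiskerLeft (F.toFunctor.obj a)) ?_
    refine Eq.mpr (congrArg IsEqToHom (whiskerLeft_μ_comp_μ F.toFunctor a ⟨n⟩ ⟨1⟩)) ?_
    exact (IsEqToHom.inv (hC.associator _ _ _)).comp ((IsEqToHom.whiskerRight ih _).comp
      ((h₁ _).comp (.map _ (FinCospan.isStrictMonoidal.associator _ _ _))))

theorem bijOn_frobeniusData :
    Set.BijOn (fun F : SymmMonFunctor FinCospan C => F.frobeniusData)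
      {F | F.IsPowerStrict} {S | S.IsSpecialCommutative} :=
  ⟨fun F _ => F.mapFrobeniusData_isSpecialCommutative FinCospan.frobeniusData_isSpecialCommutative,
    injOn_frobeniusData, fun S hS => exists_isPowerStrict_frobeniusData_eq S hS⟩

end SymmMonFunctor

theorem mainTheorem5 {C : Type u} [Category.{v} C] [MonoidalCategory C] [SymmetricCategory C] :
    Set.BijOn (fun F : SymmMonFunctor FinCospan C => F.frobeniusData)
      {F | F.IsPowerStrict} {S | S.IsSpecialCommutative} ∧
    (IsStrictMonoidal C →
      Set.BijOn (fun F : SymmMonFunctor FinCospan C => F.frobeniusData)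
        {F | F.IsStrict} {S | S.IsSpecialCommutative}) := by
  refine ⟨SymmMonFunctor.bijOn_frobeniusData, fun hC => ?_⟩
  convert SymmMonFunctor.bijOn_frobeniusData (C := C) using 1
  ext F
  exact ⟨fun h => h.isPowerStrict, fun h => h.isStrict hC⟩
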